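/- Fix a dimension $d$ and $\sigma\in\mathbb N=\{0,1,2,\dots\}$. Use the convention $\widehat f(\xi)=(2\pi)^{-d/2}\int_{\mathbb R^d}e^{-ix\cdot\xi}f(x)\,dx$. Let $\epsilon\in\{1,-1\}$, let $P:\mathbb R^d\to\mathbb R$ be (Lebesgue) measurable, and let $\chi\in\mathcal S(\mathbb R^d)$ be real-valued and even. Let $P(D)$ be the Fourier multiplier $\widehat{P(D)f}=P\widehat f$, and let $\Pi$ be the frequency cut-off $\widehat{\Pi(f)}=\chi\widehat f$, so that $\Pi(f)=K*f$ with $K(x)=(2\pi)^{-d}\int_{\mathbb R^d}e^{ix\cdot\xi}\chi(\xi)\,d\xi$. Consider the equation $$ i\partial_t u+P(D)u=\epsilon\,\bigl(\Pi(|u|^2)\bigr)^{\sigma}u. \qquad (\ast)$$ A function $u\in C(\mathbb R;L^2(\mathbb R^d))$ is called a solution of $(\ast)$ if for every $\varphi\in L^2(\mathbb R^d)$ with $P\widehat\varphi\in L^2(\mathbb R^d)$ the function $t\mapsto\langle\varphi,u(t)\rangle$ is differentiable on $\mathbb R$ and $$ i\frac{d}{dt}\langle\varphi,u(t)\rangle+\langle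 P(D)\varphi,u(t)\rangle=\epsilon\bigl\langle\varphi,(\Pi(|u(t)|^2))^\sigma u(t)\bigr\rangle\quad\text{for all }t\in\mathbb R, $$ where $\langle\cdot,\cdot\rangle$ is the $L^2$ inner product, conjugate linear in the first argument. For $s\in\mathbb N$ let $\|f\|_{H^s}^2=\int(1+|\xi|^2)^s|\widehat f(\xi)|^2d\xi$ and $\|K\|_{W^{s,\infty}}=\sum_{k=0}^s\|D^kK\|_{L^\infty}$, where $D^kK(x)$ is the $k$-th derivative and carries the operator norm of multilinear maps. Then: 1. For every $u_0\in L^2(\mathbb R^d)$ there is a unique solution $u\in C(\mathbb R;L^2(\mathbb R^d))$ of $(\ast)$ with $u|_{t=0}=u_0$, and $\|u(t)\|_{L^2}=\|u_0\|_{L^2}$ for all $t\in\mathbb R$. 2. If in addition $u_0\in H^s(\mathbb R^d)$ with $s\in\mathbb N$, then $u\in C(\mathbb R;H^s(\mathbb R^d))$. 3. The flow map $u_0\mapsto u$ is uniformly continuous from every ball of $L^2(\mathbb R^d)$ to $C(\mathbb R;L^2(\mathbb R^d))$, where the latter space carries the topology of uniform convergence on compact time intervals. More precisely, for all $u_0,v_0\in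 L^2(\mathbb R^d)$ there is a constant $C$, depending (for the fixed $d$) only on $\sigma$, $\|K\|_{L^\infty}$, $\|u_0\|_{L^2}$ and $\|v_0\|_{L^2}$, such that the solutions $u,v$ with data $u_0,v_0$ satisfy, for all $T>0$, $$\|u-v\|_{L^\infty([-T,T];L^2)}\le\|u_0-v_0\|_{L^2}\,e^{CT}.$$ 4. More generally, for every $s\in\mathbb N$ and all $u_0,v_0\in H^s(\mathbb R^d)$ there is a constant $C$, depending (for the fixed $d$ and $s$) only on $\sigma$, $\|K\|_{W^{s,\infty}}$, $\|u_0\|_{H^s}$ and $\|v_0\|_{H^s}$, such that for all $T>0$, $$\|u-v\|_{L^\infty([-T,T];H^s)}\le\|u_0-v_0\|_{H^s}\,e^{CT}.$$ -/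

import Mathlib

open MeasureTheory FourierTransform
open scoped ENNReal

noncomputable section

namespace SaturatedNLS

/-- The physical (and frequency) space `ℝ^d` with its Euclidean structure. -/
abbrev Space (d : ℕ) : Type := EuclideanSpace ℝ (Fin d)

/-- The complex Hilbert space `L²(ℝ^d)`, for the Lebesgue measure. -/
abbrev L2 (d : ℕ) : Type := Lp (α := Space d) ℂ 2

/-! Mathlib's Fourier transform is `𝓕 f w = ∫ e^{-2πi x·w} f(x) dx`, so the variable `w` corresponds
to the angular frequency `ξ = 2π w` of the convention `(2π)^{-d/2} ∫ e^{-i x·ξ} f(x) dx`.  A symbol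
`m(ξ)` thus acts on the Mathlib side as multiplication by `m(2π w)`. -/

/-- The angular frequency `ξ = 2π w`. -/
def angular {d : ℕ} (w : Space d) : Space d := (2 * Real.pi) • w

/-- The function `ξ ↦ P(ξ) \hat f(ξ)`, for `f ∈ L²`, in the variable `w = ξ / 2π`. -/
def symbolMul {d : ℕ} (P : Space d → ℝ) (f : L2 d) : Space d → ℂ :=
  fun w => (P (angular w) : ℂ) * (𝓕 f : L2 d) w

/-- The natural domain of `P(D)` in `L²`: those `f` for which `P \hat f` is in `L²`. -/
def InDomain {d : ℕ} (P : Space d → ℝ) (f : L2 d) : Prop :=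
  MemLp (symbolMul P f) 2 volume

/-- The Fourier multiplier `P(D)` on its natural domain. -/
def multiplierOp {d : ℕ} (P : Space d → ℝ) (f : L2 d) (hf : InDomain P f) : L2 d :=
  𝓕⁻ (MemLp.toLp (symbolMul P f) hf : L2 d)

/-- The frequency cut-off `Π`, the Fourier multiplier of symbol `χ`, acting on integrable
functions `f`: the product `χ \hat f` is then integrable, and `Π f` is given pointwise by the
inverse Fourier integral. -/
def cutoff {d : ℕ} (χ : SchwartzMap (Space d) ℝ) (f : Space d → ℂ) : Space d → ℂ :=
  𝓕⁻ (fun w : Space d => (χ (angular w) : ℂ) * 𝓕 f w)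

/-- The convolution kernel `K` of `Π`, that is `K(x) = (2π)^{-d} ∫ e^{i x·ξ} χ(ξ) dξ`. -/
def kernel {d : ℕ} (χ : SchwartzMap (Space d) ℝ) : Space d → ℂ :=
  𝓕⁻ (fun w : Space d => (χ (angular w) : ℂ))

/-- The norm of `W^{s,∞}(ℝ^d)`, for functions with continuous derivatives up to order `s`. -/
def wInfNorm {d : ℕ} (s : ℕ) (K : Space d → ℂ) : ℝ :=
  ∑ k ∈ Finset.range (s + 1), (eLpNorm (fun x => iteratedFDeriv ℝ k K x) ∞ volume).toReal

/-- The saturated potential `Π(|u|²)`. -/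
def potential {d : ℕ} (χ : SchwartzMap (Space d) ℝ) (u : L2 d) : Space d → ℂ :=
  cutoff χ (fun y => ((‖u y‖ ^ 2 : ℝ) : ℂ))

theorem memLp_top_fourierInv {d : ℕ} (g : Space d → ℂ) :
    MemLp (𝓕⁻ g : Space d → ℂ) ∞ volume := by
  have hb : ∀ x, ‖(𝓕⁻ g : Space d → ℂ) x‖ ≤ ∫ w, ‖g w‖ := by
    intro x
    rw [Real.fourierInv_eq]
    refine (norm_integral_le_integral_norm _).trans (le_of_eq ?_)
    simp
  refine memLp_top_of_bound ?_ _ (Filter.Eventually.of_forall hb)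
  by_cases hg : Integrable g
  · have : Continuous (𝓕⁻ g : Space d → ℂ) := by
      rw [show (𝓕⁻ g : Space d → ℂ) = fun x => (𝓕 g : Space d → ℂ) (-x) from
        funext fun x => Real.fourierInv_eq_fourier_neg g x]
      exact (VectorFourier.fourierIntegral_continuous Real.continuous_fourierChar
        (innerSL ℝ).continuous₂ hg).comp continuous_neg
    exact this.aestronglyMeasurable
  · have : (𝓕⁻ g : Space d → ℂ) = fun _ => 0 := by
      funext x
      rw [Real.fourierInv_eq_fourier_neg, Real.fourier_eq]
      exact integral_undef (fun h => hg ((Real.fourierIntegral_convergent_iff (-x)).1 h))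
    rw [this]
    exact aestronglyMeasurable_const

theorem memLp_potential_pow_mul {d : ℕ} (χ : SchwartzMap (Space d) ℝ) (σ : ℕ) (u : L2 d) :
    MemLp (fun x => potential χ u x ^ σ * u x) 2 volume := by
  have h : MemLp (fun x => potential χ u x ^ σ) ∞ volume := by
    induction σ with
    | zero => simpa using memLp_top_const (1 : ℂ)
    | succ n ih =>
      have hp : MemLp (potential χ u) ∞ volume := memLp_top_fourierInv _
      simp only [pow_succ]
      exact hp.mul (r := ∞) ih
  exact (Lp.memLp u).mul (r := 2) h

/-- The nonlinearity `(Π(|u|²))^σ u`, as an element of `L²`. -/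
def nonlinearity {d : ℕ} (χ : SchwartzMap (Space d) ℝ) (σ : ℕ) (u : L2 d) : L2 d :=
  MemLp.toLp _ (memLp_potential_pow_mul χ σ u)

/-- `u ∈ C(ℝ; L²)` solves `i ∂_t u + P(D) u = ε (Π(|u|²))^σ u`.  Since `u(t)` need not lie in the
domain of `P(D)`, the equation is tested against all `φ` in the domain of this self-adjoint
operator: `t ↦ ⟨φ, u(t)⟩` is differentiable and
`i d/dt ⟨φ, u⟩ + ⟨P(D) φ, u⟩ = ε ⟨φ, (Π(|u|²))^σ u⟩`. The inner product is conjugate linear in its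
first argument. -/
def IsSolution {d : ℕ} (P : Space d → ℝ) (χ : SchwartzMap (Space d) ℝ) (σ : ℕ) (ε : ℝ)
    (u : C(ℝ, L2 d)) : Prop :=
  ∀ (φ : L2 d) (hφ : InDomain P φ) (t : ℝ),
    ∃ a : ℂ, HasDerivAt (fun τ => inner ℂ φ (u τ)) a t ∧
      Complex.I * a + inner ℂ (multiplierOp P φ hφ) (u t)
        = (ε : ℂ) * inner ℂ φ (nonlinearity χ σ (u t))

/-- The function `ξ ↦ (1 + |ξ|²)^{s/2} \hat f(ξ)`, in the variable `w = ξ / 2π`. -/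
def besselMul {d : ℕ} (s : ℕ) (f : L2 d) : Space d → ℂ :=
  fun w => (((1 + ‖angular w‖ ^ 2) ^ ((s : ℝ) / 2) : ℝ) : ℂ) * (𝓕 f : L2 d) w

/-- `f ∈ H^s(ℝ^d)`. -/
def MemHs {d : ℕ} (s : ℕ) (f : L2 d) : Prop :=
  MemLp (besselMul s f) 2 volume

/-- The norm of `H^s(ℝ^d)`, meaningful for `f ∈ H^s(ℝ^d)`:
`‖f‖_{H^s}² = ∫ (1 + |ξ|²)^s |\hat f(ξ)|² dξ`. -/
def hsNorm {d : ℕ} (s : ℕ) (f : L2 d) : ℝ :=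
  (eLpNorm (besselMul s f) 2 volume).toReal

/-- `u ∈ C(ℝ; H^s(ℝ^d))`. -/
def ContinuousInHs {d : ℕ} (s : ℕ) (u : ℝ → L2 d) : Prop :=
  (∀ t, MemHs s (u t)) ∧
    ∀ t, Filter.Tendsto (fun τ => hsNorm s (u τ - u t)) (nhds t) (nhds 0)

end SaturatedNLS

end

/-! Put U(t) = exp(itP(D)) and v(t) = U(-t)u(t). The unbounded operator P(D) disappears, and (∗)
becomes the ordinary differential equation v' = U(-t) A(U(t)v) U(t)v in L², where A(u) is
multiplication by -iε(K * |u|²)^σ. Since |K * |u|²| ≤ ‖K‖_∞ ‖u‖², the field is locally Lipschitz.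
Since χ is real and even, K is real, so A(u) is skew-adjoint; the L² norm is conserved and solutions
are global (`exists_interaction_solution`). Grönwall's inequality on a ball, which the flow
preserves, gives uniqueness and the Lipschitz bound (`norm_interaction_sub_le`).

Weak solutions of (∗) correspond exactly to solutions of this equation (`isSolution_of_interaction`,
`interaction_of_isSolution`). For the harder direction, u is tested against U(t)φ with φ in the
domain of P(D); this domain separates points of L².

For H^s regularity, derivatives of K * |u|² fall on K, so A(u) acts boundedly on H^s with a norm
controlled by ‖u‖_{L²} alone (`hsEnergy_fourier_conv_le`). Once the L² orbit is known, the equation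
in H^s is therefore linear: its solution is global and coincides with v by uniqueness
(`exists_lift_interaction_solution`). A second Grönwall argument compares two such solutions
(`norm_lift_interaction_sub_le`). The space H^s is handled as a copy of L² through the Bessel
potential. -/

noncomputable section

namespace SaturatedNLS

open Set Filter Topology
open scoped NNReal InnerProductSpace LineDeriv

/-! ### Global solutions of Lipschitz differential equations -/

section ODE

variable {E : Type*} [NormedAddCommGroup E] [NormedSpace ℝ E]

/-- The radial retraction onto the closed ball of radius `R`. -/
def radialRetraction (R : ℝ) (x : E) : E := (R / max R ‖x‖) • x

theorem norm_radialRetraction_le {R : ℝ} (hR : 0 < R) (x : E) : ‖radialRetraction R x‖ ≤ R := by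
  have hm : 0 < max R ‖x‖ := lt_max_of_lt_left hR
  rw [radialRetraction, norm_smul, Real.norm_of_nonneg (by positivity), div_mul_eq_mul_div,
    div_le_iff₀ hm]
  gcongr
  exact le_max_right _ _

theorem norm_radialRetraction_le_norm {R : ℝ} (hR : 0 < R) (x : E) :
    ‖radialRetraction R x‖ ≤ ‖x‖ := by
  have hm : 0 < max R ‖x‖ := lt_max_of_lt_left hR
  rw [radialRetraction, norm_smul, Real.norm_of_nonneg (by positivity)]
  exact mul_le_of_le_one_left (norm_nonneg _) ((div_le_one hm).2 (le_max_left _ _))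

theorem radialRetraction_of_norm_le {R : ℝ} (hR : 0 < R) {x : E} (hx : ‖x‖ ≤ R) :
    radialRetraction R x = x := by
  rw [radialRetraction, max_eq_left hx, div_self hR.ne', one_smul]

/-- Moving the point at a fixed scale and changing the scale each cost at most ‖x - y‖. The argument
needs no inner product. -/
theorem norm_radialRetraction_sub_le {R : ℝ} (hR : 0 < R) (x y : E) :
    ‖radialRetraction R x - radialRetraction R y‖ ≤ 2 * ‖x - y‖ := by
  set a := max R ‖x‖ with ha
  set b := max R ‖y‖ with hb
  have ha0 : 0 < a := lt_max_of_lt_left hR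
  have hb0 : 0 < b := lt_max_of_lt_left hR
  have h1 : radialRetraction R x - radialRetraction R y
      = (R / a) • (x - y) + (R / a - R / b) • y := by
    simp only [radialRetraction, ← ha, ← hb]; module
  have h2 : |R / a - R / b| * ‖y‖ ≤ ‖x - y‖ := by
    have e : R / a - R / b = (R / a) * ((b - a) / b) := by field_simp
    have hab : |b - a| ≤ ‖x - y‖ := by
      rw [hb, ha, max_comm R, max_comm R]
      refine (abs_max_sub_max_le_abs _ _ _).trans ?_
      rw [abs_sub_comm]
      exact abs_norm_sub_norm_le x y
    rw [e, abs_mul, abs_div, abs_div, abs_of_pos hR, abs_of_pos ha0, abs_of_pos hb0]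
    calc R / a * (|b - a| / b) * ‖y‖ = (R / a) * (‖y‖ / b) * |b - a| := by ring
      _ ≤ 1 * 1 * ‖x - y‖ := by
        gcongr
        · exact (div_le_one ha0).2 (le_max_left _ _)
        · exact (div_le_one hb0).2 (le_max_right _ _)
      _ = _ := by ring
  rw [h1]
  refine (norm_add_le _ _).trans ?_
  rw [norm_smul, norm_smul, Real.norm_of_nonneg (by positivity : 0 ≤ R / a), Real.norm_eq_abs]
  have h3 : R / a * ‖x - y‖ ≤ ‖x - y‖ :=
    mul_le_of_le_one_left (norm_nonneg _) ((div_le_one ha0).2 (le_max_left _ _))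
  linarith

theorem gronwallBound_le {δ K ε x : ℝ} (hK : 0 ≤ K) (hε : 0 ≤ ε) :
    gronwallBound δ K ε x ≤ (δ + ε * x) * Real.exp (K * x) := by
  rcases hK.eq_or_lt with rfl | hK
  · simp [gronwallBound_K0]
  rw [gronwallBound_of_K_ne_0 hK.ne']
  -- This is 1 - y ≤ exp(-y), with y = Kx, multiplied by exp(y). It removes the division by K, so
  -- one formula also covers K = 0.
  have h : Real.exp (K * x) - 1 ≤ K * x * Real.exp (K * x) := by
    have := Real.add_one_le_exp (-(K * x))
    have h2 := mul_le_mul_of_nonneg_right this (Real.exp_pos (K * x)).le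
    rw [← Real.exp_add] at h2
    simp at h2
    linarith
  have h3 : ε / K * (Real.exp (K * x) - 1) ≤ ε / K * (K * x * Real.exp (K * x)) := by gcongr
  have h4 : ε / K * (K * x * Real.exp (K * x)) = ε * x * Real.exp (K * x) := by field_simp
  simp only [add_mul]
  linarith

/-- Grönwall's inequality on a symmetric interval. -/
theorem norm_le_of_norm_deriv_le {f f' : ℝ → E} {K ε T : ℝ} (hK : 0 ≤ K) (hε : 0 ≤ ε)
    (hf : ∀ t ∈ Icc (-T) T, HasDerivWithinAt f (f' t) (Icc (-T) T) t)
    (hb : ∀ t ∈ Icc (-T) T, ‖f' t‖ ≤ K * ‖f t‖ + ε) :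
    ∀ t ∈ Icc (-T) T, ‖f t‖ ≤ (‖f 0‖ + ε * T) * Real.exp (K * T) := by
  have key : ∀ (f f' : ℝ → E),
      (∀ t ∈ Icc (-T) T, HasDerivWithinAt f (f' t) (Icc (-T) T) t) →
      (∀ t ∈ Icc (-T) T, ‖f' t‖ ≤ K * ‖f t‖ + ε) →
      ∀ t ∈ Icc 0 T, ‖f t‖ ≤ (‖f 0‖ + ε * T) * Real.exp (K * T) := by
    intro f f' hf hb t ht
    have hT : 0 ≤ T := ht.1.trans ht.2
    have hsub : Icc 0 T ⊆ Icc (-T) T := Icc_subset_Icc (by linarith) le_rfl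
    have h := norm_le_gronwallBound_of_norm_deriv_right_le (f := f) (f' := f') (δ := ‖f 0‖)
      (K := K) (ε := ε) (a := 0) (b := T)
      (fun x hx => ((hf x (hsub hx)).continuousWithinAt).mono hsub)
      (fun x hx => by
        have h1 := (hf x (hsub (Ico_subset_Icc_self hx))).mono
          (Icc_subset_Icc (by linarith [hx.1] : -T ≤ x) le_rfl)
        exact h1.mono_of_mem_nhdsWithin (Icc_mem_nhdsGE hx.2))
      le_rfl (fun x hx => hb x (hsub (Ico_subset_Icc_self hx))) t ht
    rw [sub_zero] at h
    refine h.trans ((gronwallBound_le hK hε).trans ?_)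
    gcongr
    · exact ht.2
    · exact ht.2
  intro t ht
  rcases le_total 0 t with h0 | h0
  · exact key f f' hf hb t ⟨h0, ht.2⟩
  -- Negative times follow by time reversal.
  · have := key (fun s => f (-s)) (fun s => -f' (-s)) (fun s hs => by
        have hs' : -s ∈ Icc (-T) T := ⟨by linarith [hs.2], by linarith [hs.1]⟩
        have := (hf (-s) hs').scomp s ((hasDerivAt_neg s).hasDerivWithinAt (s := Icc (-T) T))
          (fun r hr => ⟨by linarith [hr.2], by linarith [hr.1]⟩)
        simpa [Function.comp_def] using this)
      (fun s hs => by
        have hs' : -s ∈ Icc (-T) T := ⟨by linarith [hs.2], by linarith [hs.1]⟩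
        simpa using hb (-s) hs') (-t) ⟨by linarith, by linarith [ht.1]⟩
    simpa using this

/-- Composing with the retraction makes the field bounded, so Picard–Lindelöf applies on the whole
interval. The truncated field still grows at most like K‖x‖ + M, so Grönwall's inequality keeps the
solution inside the ball where the truncation is invisible. -/
theorem exists_solution_Icc [CompleteSpace E] {F : ℝ → E → E} {K : ℝ≥0}
    (hc : ∀ x, Continuous fun t => F t x) (hL : ∀ t, LipschitzWith K (F t)) (x₀ : E)
    {T : ℝ} (hT : 0 ≤ T) :
    ∃ α : ℝ → E, α 0 = x₀ ∧
      ∀ t ∈ Icc (-T) T, HasDerivWithinAt α (F t (α t)) (Icc (-T) T) t := by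
  obtain ⟨M, hM⟩ := (isCompact_Icc (a := -T) (b := T)).exists_bound_of_continuousOn
    (hc 0).continuousOn
  have h0T : (0 : ℝ) ∈ Icc (-T) T := ⟨by linarith, hT⟩
  have hM0 : 0 ≤ M := (norm_nonneg _).trans (hM 0 h0T)
  set R : ℝ := (‖x₀‖ + M * T) * Real.exp (K * T) + 1 with hRdef
  have hR : 0 < R := by positivity
  have hFb : ∀ t ∈ Icc (-T) T, ∀ x, ‖F t x‖ ≤ K * ‖x‖ + M := by
    intro t ht x
    have h := (hL t).dist_le_mul x 0
    rw [dist_eq_norm, dist_zero_right] at h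
    calc ‖F t x‖ = ‖(F t x - F t 0) + F t 0‖ := by rw [sub_add_cancel]
      _ ≤ _ := (norm_add_le _ _).trans (add_le_add h (hM t ht))
  -- The speed is at most L everywhere, so a ball of radius L T about x₀ contains the trajectory,
  -- without any smallness of T.
  let L : ℝ≥0 := ⟨K * R + M, by positivity⟩
  have hPL : IsPicardLindelof (fun t x => F t (radialRetraction R x)) (tmin := -T) (tmax := T)
      ⟨0, h0T⟩ x₀ (L * ⟨T, hT⟩) 0 L (K * 2) := by
    refine ⟨fun t _ => LipschitzWith.lipschitzOnWith ?_, fun x _ => (hc _).continuousOn,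
      fun t ht x _ => (hFb t ht _).trans ?_, ?_⟩
    · exact (hL t).comp (LipschitzWith.of_dist_le_mul fun x y => by
        simpa [dist_eq_norm] using norm_radialRetraction_sub_le hR x y)
    · change _ ≤ (K : ℝ) * R + M
      gcongr
      exact norm_radialRetraction_le hR x
    · simp only [sub_zero, zero_sub, neg_neg, max_self, NNReal.coe_zero]
      exact le_rfl
  obtain ⟨α, hα0, hα⟩ := hPL.exists_eq_forall_mem_Icc_hasDerivWithinAt₀
  change α 0 = x₀ at hα0
  have hb := norm_le_of_norm_deriv_le (K := K) (ε := M) K.2 hM0 hα (fun t ht =>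
    (hFb t ht _).trans (by gcongr; exact norm_radialRetraction_le_norm hR _))
  refine ⟨α, hα0, fun t ht => ?_⟩
  have := hα t ht
  rwa [radialRetraction_of_norm_le hR] at this
  have := hb t ht
  rw [hα0] at this
  linarith

/-- A time dependent vector field which is continuous in time and uniformly Lipschitz in space has
global solutions. -/
theorem exists_global_solution [CompleteSpace E] {F : ℝ → E → E} {K : ℝ≥0}
    (hc : ∀ x, Continuous fun t => F t x) (hL : ∀ t, LipschitzWith K (F t)) (x₀ : E) :
    ∃ α : ℝ → E, α 0 = x₀ ∧ ∀ t, HasDerivAt α (F t (α t)) t := by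
  choose α hα0 hα using fun n : ℕ => exists_solution_Icc hc hL x₀ (T := n + 1) (by positivity)
  have hderiv : ∀ n : ℕ, ∀ t ∈ Ioo (-(n + 1 : ℝ)) (n + 1), HasDerivAt (α n) (F t (α n t)) t :=
    fun n t ht => (hα n t (Ioo_subset_Icc_self ht)).hasDerivAt (Icc_mem_nhds ht.1 ht.2)
  have heq : ∀ n m : ℕ, n ≤ m → EqOn (α n) (α m) (Ioo (-(n + 1 : ℝ)) (n + 1)) := by
    intro n m hnm
    have hnm' : (n : ℝ) ≤ m := by exact_mod_cast hnm
    refine ODE_solution_unique_of_mem_Ioo (v := F) (s := fun _ => univ) (t₀ := 0) (K := K)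
      (fun t _ => (hL t).lipschitzOnWith)
      ⟨by linarith [n.cast_nonneg (α := ℝ)], by positivity⟩
      (fun t ht => ⟨hderiv n t ht, trivial⟩) (fun t ht => ⟨hderiv m t ?_, trivial⟩)
      ((hα0 n).trans (hα0 m).symm)
    exact ⟨by linarith [ht.1], by linarith [ht.2]⟩
  refine ⟨fun t => α ⌈|t|⌉₊ t, hα0 _, fun t => ?_⟩
  have hmem : ∀ (t : ℝ) (n : ℕ), ⌈|t|⌉₊ ≤ n → t ∈ Ioo (-(n + 1 : ℝ)) (n + 1) := by
    intro t n hn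
    have h1 : |t| ≤ n := Nat.ceil_le.1 hn
    rw [abs_le] at h1
    exact ⟨by linarith [h1.1], by linarith [h1.2]⟩
  -- The extra 1 makes n an upper bound for ⌈|s|⌉ for all s near t, so a single local solution
  -- represents the glued one there.
  set n := ⌈|t|⌉₊ + 1 with hn
  have hev : (fun s => α ⌈|s|⌉₊ s) =ᶠ[𝓝 t] α n := by
    have : ∀ᶠ s in 𝓝 t, |s| < (n : ℝ) :=
      (continuous_abs.tendsto t).eventually_lt_const (by
        rw [hn]; push_cast; linarith [Nat.le_ceil |t|])
    filter_upwards [this] with s hs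
    exact heq _ _ (Nat.ceil_le.2 hs.le) (hmem s _ le_rfl)
  have h1 : α ⌈|t|⌉₊ t = α n t := hev.self_of_nhds
  change HasDerivAt _ (F t (α ⌈|t|⌉₊ t)) t
  rw [h1]
  exact (hderiv n t (hmem t n (by omega))).congr_of_eventuallyEq hev

end ODE


/-! ### Interaction picture for an isometric group and an operator valued nonlinearity -/

section Abstract

variable {E : Type*} [NormedAddCommGroup E]
variable {G : Type*} [NormedAddCommGroup G] [InnerProductSpace ℂ G]

/-- A strongly continuous group of linear isometries. -/
structure IsIsometricGroup (U : ℝ → G →L[ℂ] G) : Prop where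
  zero : ∀ x, U 0 x = x
  add : ∀ s t x, U (s + t) x = U s (U t x)
  norm : ∀ t x, ‖U t x‖ = ‖x‖
  cont : ∀ x, Continuous fun t => U t x

/-- An operator valued map which is bounded by `M R` and `L R`-Lipschitz on the ball of radius
`R`. -/
structure IsLocallyLipschitz (A : E → G →L[ℂ] G) (M L : ℝ → ℝ) : Prop where
  bound : ∀ R u, ‖u‖ ≤ R → ‖A u‖ ≤ M R
  lip : ∀ R u v, ‖u‖ ≤ R → ‖v‖ ≤ R → ‖A u - A v‖ ≤ L R * ‖u - v‖
  nonneg : ∀ R, 0 ≤ R → 0 ≤ L R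

namespace IsIsometricGroup

variable {U : ℝ → G →L[ℂ] G} (hU : IsIsometricGroup U)
include hU

theorem apply_neg (t : ℝ) (x : G) : U t (U (-t) x) = x := by
  rw [← hU.add, add_neg_cancel, hU.zero]

/-- Strong continuity gives joint continuity because the error term U(τ r)(y r - y s) has norm ‖y r
- y s‖, whatever τ r is. -/
theorem continuous_apply {X : Type*} [TopologicalSpace X] {τ : X → ℝ} {y : X → G}
    (hτ : Continuous τ) (hy : Continuous y) : Continuous fun s => U (τ s) (y s) := by
  rw [continuous_iff_continuousAt]
  intro s
  have h1 : Tendsto (fun r => U (τ r) (y s)) (𝓝 s) (𝓝 (U (τ s) (y s))) :=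
    ((hU.cont (y s)).comp hτ).continuousAt
  have h2 : Tendsto (fun r => U (τ r) (y r - y s)) (𝓝 s) (𝓝 0) := by
    rw [tendsto_zero_iff_norm_tendsto_zero]
    simp only [hU.norm]
    rw [← tendsto_zero_iff_norm_tendsto_zero, tendsto_sub_nhds_zero_iff]
    exact hy.continuousAt
  have h3 := h1.add h2
  simpa [ContinuousAt] using h3

/-- The isometries are invertible, hence unitary, and the adjoint of U(t) is its inverse U(-t). -/
theorem inner_neg (t : ℝ) (x y : G) : inner ℂ x (U (-t) y) = inner ℂ (U t x) y := by
  let V : G →ₗᵢ[ℂ] G := ⟨(U t : G →ₗ[ℂ] G), hU.norm t⟩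
  have h := V.inner_map_map x (U (-t) y)
  change inner ℂ (U t x) (U t (U (-t) y)) = _ at h
  rw [hU.apply_neg] at h
  exact h.symm

end IsIsometricGroup

namespace IsLocallyLipschitz

variable {A : E → G →L[ℂ] G} {M L : ℝ → ℝ} (hA : IsLocallyLipschitz A M L)
include hA

theorem bound_nonneg {R : ℝ} (hR : 0 ≤ R) : 0 ≤ M R :=
  (norm_nonneg _).trans (hA.bound R 0 (by simpa using hR))

theorem continuous : Continuous A := by
  rw [continuous_iff_continuousAt]
  intro u
  have h : LipschitzOnWith (L (‖u‖ + 1)).toNNReal A (Metric.ball 0 (‖u‖ + 1)) := by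
    refine LipschitzOnWith.of_dist_le_mul fun x hx y hy => ?_
    rw [Real.coe_toNNReal _ (hA.nonneg _ (by positivity)), dist_eq_norm, dist_eq_norm]
    exact hA.lip _ x y (by simpa using (mem_ball_zero_iff.1 hx).le)
      (by simpa using (mem_ball_zero_iff.1 hy).le)
  exact h.continuousOn.continuousAt (Metric.isOpen_ball.mem_nhds (by simp))

end IsLocallyLipschitz

theorem norm_apply_sub_apply_le {A : E → G →L[ℂ] G} {M L : ℝ → ℝ} (hA : IsLocallyLipschitz A M L)
    {R : ℝ} {u v : E} (hu : ‖u‖ ≤ R) (hv : ‖v‖ ≤ R) (x y : G) :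
    ‖A u x - A v y‖ ≤ M R * ‖x - y‖ + L R * ‖u - v‖ * ‖y‖ := by
  have : A u x - A v y = A u (x - y) + (A u - A v) y := by simp
  rw [this]
  refine (norm_add_le _ _).trans (add_le_add ?_ ?_)
  · exact (A u).le_of_opNorm_le (hA.bound R u hu) _
  · exact (A u - A v).le_of_opNorm_le (hA.lip R u v hu hv) _

variable [InnerProductSpace ℂ E]

/-- The vector field `v ↦ U(-t) A(U(t) v) U(t) v` of the equation satisfied by `v = U(-t) u`. -/
def interactionField (U : ℝ → E →L[ℂ] E) (A : E → E →L[ℂ] E) (t : ℝ) (v : E) : E :=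
  U (-t) (A (U t v) (U t v))

variable [NormedSpace ℝ E] [NormedSpace ℝ G]
variable {U : ℝ → E →L[ℂ] E} {A : E → E →L[ℂ] E} {M L : ℝ → ℝ}

theorem norm_eq_of_re_inner_eq_zero {v v' : ℝ → E} (hv : ∀ t, HasDerivAt v (v' t) t)
    (h : ∀ t, (inner ℂ (v t) (v' t)).re = 0) (t : ℝ) : ‖v t‖ = ‖v 0‖ := by
  have hd : ∀ t, HasDerivAt (fun t => inner ℂ (v t) (v t)) 0 t := by
    intro t
    have h1 := (hv t).inner ℂ (hv t)
    have h2 : inner ℂ (v t) (v' t) + inner ℂ (v' t) (v t) = (0 : ℂ) := by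
      rw [← inner_conj_symm (v' t) (v t), Complex.add_conj, h t]; simp
    rwa [h2] at h1
  have h3 := is_const_of_deriv_eq_zero (fun t => (hd t).differentiableAt) (fun t => (hd t).deriv)
    t 0
  simp only [inner_self_eq_norm_sq_to_K] at h3
  have h4 : ‖v t‖ ^ 2 = ‖v 0‖ ^ 2 := by exact_mod_cast h3
  exact (pow_left_inj₀ (norm_nonneg _) (norm_nonneg _) two_ne_zero).1 h4

theorem norm_interaction_eq (hU : IsIsometricGroup U)
    (hskew : ∀ u x, (inner ℂ x (A u x)).re = 0) {v : ℝ → E}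
    (hv : ∀ t, HasDerivAt v (interactionField U A t (v t)) t) (t : ℝ) : ‖v t‖ = ‖v 0‖ :=
  norm_eq_of_re_inner_eq_zero hv (fun t => by
    rw [interactionField, hU.inner_neg, hskew]) t

/-- The field truncated by ρ is globally Lipschitz. It still conserves the norm: ρ w is a real
multiple of w, so A(ρ w)(ρ w) is a real multiple of A(ρ w)w, whose pairing with w has zero real
part. The solution thus stays in the ball where ρ is the identity. -/
theorem exists_interaction_solution [CompleteSpace E] [IsScalarTower ℝ ℂ E]
    (hU : IsIsometricGroup U) (hA : IsLocallyLipschitz A M L)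
    (hskew : ∀ u x, (inner ℂ x (A u x)).re = 0) (u₀ : E) :
    ∃ v : ℝ → E, v 0 = u₀ ∧ ∀ t, HasDerivAt v (interactionField U A t (v t)) t := by
  set R : ℝ := ‖u₀‖ + 1 with hRdef
  have hR : 0 < R := by positivity
  let ρ : E → E := radialRetraction R
  let F : ℝ → E → E := fun t v => U (-t) (A (ρ (U t v)) (ρ (U t v)))
  have hρ : LipschitzWith 2 ρ := LipschitzWith.of_dist_le_mul fun x y => by
    simpa [dist_eq_norm] using norm_radialRetraction_sub_le hR x y
  have hMR := hA.bound_nonneg hR.le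
  have hLR := hA.nonneg R hR.le
  have hFc : ∀ x, Continuous fun t => F t x := by
    intro x
    have h1 : Continuous fun t => ρ (U t x) := hρ.continuous.comp (hU.cont x)
    exact hU.continuous_apply continuous_neg ((hA.continuous.comp h1).clm_apply h1)
  let K : ℝ≥0 := ⟨2 * (M R + L R * R), by positivity⟩
  have hFL : ∀ t, LipschitzWith K (F t) := by
    intro t
    refine LipschitzWith.of_dist_le_mul fun x y => ?_
    change _ ≤ 2 * (M R + L R * R) * _
    rw [dist_eq_norm, dist_eq_norm]
    change ‖U (-t) _ - U (-t) _‖ ≤ _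
    rw [← map_sub, hU.norm]
    refine (norm_apply_sub_apply_le hA (norm_radialRetraction_le hR _)
      (norm_radialRetraction_le hR _) _ _).trans ?_
    have h1 : ‖ρ (U t x) - ρ (U t y)‖ ≤ 2 * ‖x - y‖ := by
      refine (norm_radialRetraction_sub_le hR _ _).trans_eq ?_
      rw [← map_sub, hU.norm]
    have h2 : ‖ρ (U t y)‖ ≤ R := norm_radialRetraction_le hR _
    calc _ ≤ M R * (2 * ‖x - y‖) + L R * (2 * ‖x - y‖) * R := by gcongr
      _ = _ := by ring
  obtain ⟨v, hv0, hv⟩ := exists_global_solution hFc hFL u₀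
  have hnorm : ∀ t, ‖v t‖ = ‖v 0‖ := norm_eq_of_re_inner_eq_zero hv (fun t => by
    change (inner ℂ (v t) (U (-t) (A (ρ (U t (v t))) (ρ (U t (v t)))))).re = 0
    rw [hU.inner_neg]
    have : ∀ w : E, ρ w = ((R / max R ‖w‖ : ℝ) : ℂ) • w := fun w => by
      change (R / max R ‖w‖) • w = _
      exact (algebraMap_smul ℂ _ w).symm
    conv_lhs => enter [1, 3]; rw [this (U t (v t)), map_smul, ← this]
    rw [inner_smul_right, Complex.re_ofReal_mul, hskew, mul_zero])
  refine ⟨v, hv0, fun t => ?_⟩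
  have hρv : ρ (U t (v t)) = U t (v t) :=
    radialRetraction_of_norm_le hR (by rw [hU.norm, hnorm, hv0]; linarith)
  have := hv t
  change HasDerivAt v (U (-t) (A (ρ (U t (v t))) (ρ (U t (v t))))) t at this
  rwa [hρv] at this

theorem norm_interaction_sub_le (hU : IsIsometricGroup U) (hA : IsLocallyLipschitz A M L)
    (hskew : ∀ u x, (inner ℂ x (A u x)).re = 0) {v w : ℝ → E}
    (hv : ∀ t, HasDerivAt v (interactionField U A t (v t)) t)
    (hw : ∀ t, HasDerivAt w (interactionField U A t (w t)) t)
    {R : ℝ} (hvR : ‖v 0‖ ≤ R) (hwR : ‖w 0‖ ≤ R) {t T : ℝ} (ht : t ∈ Icc (-T) T) :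
    ‖v t - w t‖ ≤ ‖v 0 - w 0‖ * Real.exp ((M R + L R * R) * T) := by
  have hR : 0 ≤ R := (norm_nonneg _).trans hvR
  have hMR := hA.bound_nonneg hR
  have hLR := hA.nonneg R hR
  have h := norm_le_of_norm_deriv_le (f := fun t => v t - w t) (K := M R + L R * R) (ε := 0) (T := T)
    (by positivity) le_rfl
    (fun t _ => ((hv t).sub (hw t)).hasDerivWithinAt) (fun t _ => ?_) t ht
  · simpa using h
  have hvt : ‖U t (v t)‖ ≤ R := by rw [hU.norm, norm_interaction_eq hU hskew hv]; exact hvR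
  have hwt : ‖U t (w t)‖ ≤ R := by rw [hU.norm, norm_interaction_eq hU hskew hw]; exact hwR
  rw [interactionField, interactionField, ← map_sub, hU.norm]
  refine (norm_apply_sub_apply_le hA hvt hwt _ _).trans ?_
  rw [← map_sub, hU.norm]
  calc _ ≤ M R * ‖v t - w t‖ + L R * ‖v t - w t‖ * R := by gcongr
    _ = _ := by ring

/-! Propagation of regularity in a smaller space `G`, embedded in `E` through `B`. -/

variable {V : ℝ → G →L[ℂ] G} {A' : E → G →L[ℂ] G} {M' L' : ℝ → ℝ} {B : G →L[ℂ] E}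

/-- The coefficient A'(U(t)v(t)) involves only the known orbit in E, so the equation for g is linear
with a coefficient bounded by M' R; it has a global solution without any conserved norm in G. Both B
g and v solve the same linear equation in E, so they agree. -/
theorem exists_lift_interaction_solution [CompleteSpace G] [IsScalarTower ℝ ℂ E]
    [IsScalarTower ℝ ℂ G] (hU : IsIsometricGroup U) (hA : IsLocallyLipschitz A M L)
    (hskew : ∀ u x, (inner ℂ x (A u x)).re = 0)
    (hV : IsIsometricGroup V) (hA' : IsLocallyLipschitz A' M' L')
    (hBU : ∀ t g, B (V t g) = U t (B g)) (hBA : ∀ u g, B (A' u g) = A u (B g))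
    {v : ℝ → E} (hv : ∀ t, HasDerivAt v (interactionField U A t (v t)) t)
    {g₀ : G} (h0 : v 0 = B g₀) :
    ∃ g : ℝ → G, g 0 = g₀ ∧ (∀ t, B (g t) = v t) ∧
      ∀ t, HasDerivAt g (V (-t) (A' (U t (v t)) (V t (g t)))) t := by
  set R := ‖v 0‖ with hRdef
  have hR : 0 ≤ R := norm_nonneg _
  have hvt : ∀ t, ‖U t (v t)‖ ≤ R := fun t => by
    rw [hU.norm, norm_interaction_eq hU hskew hv]
  have hvc : Continuous v := continuous_iff_continuousAt.2 fun t => (hv t).continuousAt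
  have huc : Continuous fun t => U t (v t) := hU.continuous_apply continuous_id hvc
  obtain ⟨g, hg0, hg⟩ := exists_global_solution
    (F := fun t g => V (-t) (A' (U t (v t)) (V t g))) (K := ⟨M' R, hA'.bound_nonneg hR⟩)
    (fun x => hV.continuous_apply continuous_neg
      ((hA'.continuous.comp huc).clm_apply (hV.cont x)))
    (fun t => LipschitzWith.of_dist_le_mul fun x y => by
      rw [dist_eq_norm, dist_eq_norm, ← map_sub, hV.norm, ← map_sub, ← map_sub]
      refine ((A' _).le_of_opNorm_le (hA'.bound R _ (hvt t)) _).trans_eq ?_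
      rw [hV.norm]; rfl) g₀
  refine ⟨g, hg0, fun t => ?_, hg⟩
  have hBg : ∀ t, HasDerivAt (fun t => B (g t)) (U (-t) (A (U t (v t)) (U t (B (g t))))) t := by
    intro t
    have := ((B.restrictScalars ℝ).hasFDerivAt (x := g t)).comp_hasDerivAt t (hg t)
    simpa [Function.comp_def, hBU, hBA] using this
  have h := ODE_solution_unique_univ (v := fun t x => U (-t) (A (U t (v t)) (U t x)))
    (s := fun _ => univ) (K := ⟨M R, hA.bound_nonneg hR⟩) (t₀ := 0)
    (f := fun t => B (g t)) (g := v)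
    (fun t => LipschitzWith.lipschitzOnWith <| LipschitzWith.of_dist_le_mul fun x y => by
      rw [dist_eq_norm, dist_eq_norm, ← map_sub, hU.norm, ← map_sub, ← map_sub]
      refine ((A _).le_of_opNorm_le (hA.bound R _ (hvt t)) _).trans_eq ?_
      rw [hU.norm]; rfl)
    (fun t => ⟨hBg t, trivial⟩) (fun t => ⟨hv t, trivial⟩) (by rw [hg0, h0])
  exact congrFun h t

/-- The difference g - h solves a linear equation of rate M' R, with a forcing bounded by L' R times
the distance of the orbits in E times the size of h. These two factors grow at rates C and M' R. The
prefactor 1 + L' R² T left by Grönwall's inequality is absorbed into an exponential, so that ‖g 0 -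
h 0‖ keeps the constant 1. -/
theorem norm_lift_interaction_sub_le (hU : IsIsometricGroup U) (hA : IsLocallyLipschitz A M L)
    (hskew : ∀ u x, (inner ℂ x (A u x)).re = 0)
    (hV : IsIsometricGroup V) (hA' : IsLocallyLipschitz A' M' L') (hB : ∀ g, ‖B g‖ ≤ ‖g‖)
    {v w : ℝ → E} (hv : ∀ t, HasDerivAt v (interactionField U A t (v t)) t)
    (hw : ∀ t, HasDerivAt w (interactionField U A t (w t)) t)
    {g h : ℝ → G} (hgv : ∀ t, B (g t) = v t) (hhw : ∀ t, B (h t) = w t)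
    (hg : ∀ t, HasDerivAt g (V (-t) (A' (U t (v t)) (V t (g t)))) t)
    (hh : ∀ t, HasDerivAt h (V (-t) (A' (U t (w t)) (V t (h t)))) t)
    {R : ℝ} (hgR : ‖g 0‖ ≤ R) (hhR : ‖h 0‖ ≤ R) {t T : ℝ} (hT : 0 ≤ T) (ht : t ∈ Icc (-T) T) :
    ‖g t - h t‖ ≤ ‖g 0 - h 0‖ * Real.exp ((2 * M' R + (M R + L R * R) + L' R * R) * T) := by
  have hR : 0 ≤ R := (norm_nonneg _).trans hgR
  have hMR := hA.bound_nonneg hR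
  have hLR := hA.nonneg R hR
  have hMR' := hA'.bound_nonneg hR
  have hLR' := hA'.nonneg R hR
  have hv0 : ‖v 0‖ ≤ R := by rw [← hgv]; exact (hB _).trans hgR
  have hw0 : ‖w 0‖ ≤ R := by rw [← hhw]; exact (hB _).trans hhR
  have hvt : ∀ t, ‖U t (v t)‖ ≤ R := fun t => by
    rw [hU.norm, norm_interaction_eq hU hskew hv]; exact hv0
  have hwt : ∀ t, ‖U t (w t)‖ ≤ R := fun t => by
    rw [hU.norm, norm_interaction_eq hU hskew hw]; exact hw0
  set C := M R + L R * R with hC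
  have hC0 : 0 ≤ C := by positivity
  have hd0 : ‖v 0 - w 0‖ ≤ ‖g 0 - h 0‖ := by
    rw [← hgv, ← hhw, ← map_sub]; exact hB _
  have hhb : ∀ t ∈ Icc (-T) T, ‖h t‖ ≤ R * Real.exp (M' R * T) := by
    intro t ht
    refine (norm_le_of_norm_deriv_le (f := h) (K := M' R) (ε := 0) (T := T) hMR' le_rfl
      (fun t _ => (hh t).hasDerivWithinAt) (fun t _ => ?_) t ht).trans ?_
    · rw [hV.norm, add_zero]
      refine ((A' _).le_of_opNorm_le (hA'.bound R _ (hwt t)) _).trans_eq ?_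
      rw [hV.norm]
    · rw [zero_mul, add_zero]; gcongr
  set ε := L' R * (‖g 0 - h 0‖ * Real.exp (C * T)) * (R * Real.exp (M' R * T)) with hε
  have key := norm_le_of_norm_deriv_le (f := fun t => g t - h t) (K := M' R) (ε := ε) (T := T) hMR'
    (by positivity) (fun t _ => ((hg t).sub (hh t)).hasDerivWithinAt) (fun t ht => ?_) t ht
  · refine key.trans ?_
    have h1 : (1 : ℝ) ≤ Real.exp (C * T) * Real.exp (M' R * T) := by
      rw [← Real.exp_add]; exact Real.one_le_exp (by positivity)
    have h2 : 1 + L' R * R * T ≤ Real.exp (L' R * R * T) := by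
      linarith [Real.add_one_le_exp (L' R * R * T)]
    calc (‖g 0 - h 0‖ + ε * T) * Real.exp (M' R * T)
        = ‖g 0 - h 0‖ * (1 + L' R * R * T * (Real.exp (C * T) * Real.exp (M' R * T)))
          * Real.exp (M' R * T) := by rw [hε]; ring
      _ ≤ ‖g 0 - h 0‖ * (1 * (Real.exp (C * T) * Real.exp (M' R * T))
          + L' R * R * T * (Real.exp (C * T) * Real.exp (M' R * T))) * Real.exp (M' R * T) := by
        gcongr; linarith
      _ = ‖g 0 - h 0‖ * ((1 + L' R * R * T) * (Real.exp (C * T) * Real.exp (M' R * T)))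
          * Real.exp (M' R * T) := by ring
      _ ≤ ‖g 0 - h 0‖ * (Real.exp (L' R * R * T) * (Real.exp (C * T) * Real.exp (M' R * T)))
          * Real.exp (M' R * T) := by gcongr
      _ = _ := by
        rw [mul_assoc, ← Real.exp_add, ← Real.exp_add, ← Real.exp_add]
        congr 2; ring
  · rw [← map_sub, hV.norm]
    refine (norm_apply_sub_apply_le hA' (hvt t) (hwt t) _ _).trans ?_
    rw [← map_sub, ← map_sub, hV.norm, hU.norm, hV.norm, hε]
    gcongr
    · exact (norm_interaction_sub_le hU hA hskew hv hw hv0 hw0 ht).trans (by gcongr)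
    · exact hhb t ht

end Abstract


/-! ### Multiplication operators on `L²` -/

section Multiplication

variable {α : Type*} [MeasurableSpace α] {μ : Measure α}

/-- Multiplication by an essentially bounded function, as an operator on `L²`. -/
def mulL (m : α → ℂ) (hm : MemLp m ∞ μ) : Lp ℂ 2 μ →L[ℂ] Lp ℂ 2 μ :=
  (ContinuousLinearMap.mul ℂ ℂ).holderL μ ∞ 2 2 (hm.toLp m)

theorem coeFn_mulL (m : α → ℂ) (hm : MemLp m ∞ μ) (f : Lp ℂ 2 μ) :
    mulL m hm f =ᵐ[μ] fun x => m x * f x := by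
  have h1 := (ContinuousLinearMap.mul ℂ ℂ).coeFn_holder (r := 2) (hm.toLp m) f
  filter_upwards [h1, hm.coeFn_toLp] with x hx hx'
  change ((ContinuousLinearMap.mul ℂ ℂ).holder 2 (hm.toLp m) f) x = _
  rw [hx, hx']; rfl

theorem mulL_eq_of_ae {m : α → ℂ} {hm : MemLp m ∞ μ} {f g : Lp ℂ 2 μ}
    (h : g =ᵐ[μ] fun x => m x * f x) : mulL m hm f = g :=
  Lp.ext ((coeFn_mulL m hm f).trans h.symm)

theorem norm_mulL_apply_le {m : α → ℂ} (hm : MemLp m ∞ μ) {C : ℝ} (hC : ∀ᵐ x ∂μ, ‖m x‖ ≤ C)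
    (f : Lp ℂ 2 μ) : ‖mulL m hm f‖ ≤ C * ‖f‖ := by
  refine Lp.norm_le_mul_norm_of_ae_le_mul ?_
  filter_upwards [coeFn_mulL m hm f, hC] with x hx hCx
  rw [hx, norm_mul]
  gcongr

/-- Dominated convergence in `L²`. -/
theorem tendsto_Lp_of_dominated {ι : Type*} {l : Filter ι} [l.IsCountablyGenerated]
    {f : ι → Lp ℂ 2 μ} {g : Lp ℂ 2 μ} (F : ι → α → ℂ) (b : α → ℂ) (hF : ∀ i, f i =ᵐ[μ] F i)
    (hb : MemLp b 2 μ) (hbd : ∀ᶠ i in l, ∀ᵐ x ∂μ, ‖F i x - g x‖ ≤ ‖b x‖)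
    (hlim : ∀ᵐ x ∂μ, Tendsto (fun i => F i x) l (𝓝 (g x))) : Tendsto f l (𝓝 g) := by
  have h2 : ∀ h : α → ℂ, eLpNorm h 2 μ = (∫⁻ x, ‖h x‖ₑ ^ (2 : ℝ) ∂μ) ^ (1 / 2 : ℝ) := fun h => by
    rw [eLpNorm_eq_lintegral_rpow_enorm_toReal (by norm_num) (by norm_num)]; norm_num
  rw [Lp.tendsto_Lp_iff_tendsto_eLpNorm']
  have hcongr : ∀ i, eLpNorm (⇑(f i) - ⇑g) 2 μ
      = (∫⁻ x, ‖F i x - g x‖ₑ ^ (2 : ℝ) ∂μ) ^ (1 / 2 : ℝ) := fun i => by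
    rw [← h2]
    exact eLpNorm_congr_ae ((hF i).sub EventuallyEq.rfl)
  simp only [hcongr]
  have h0 : Tendsto (fun i => ∫⁻ x, ‖F i x - g x‖ₑ ^ (2 : ℝ) ∂μ) l (𝓝 (∫⁻ _, 0 ∂μ)) := by
    refine tendsto_lintegral_filter_of_dominated_convergence' (fun x => ‖b x‖ₑ ^ (2 : ℝ)) ?_ ?_ ?_ ?_
    · refine Eventually.of_forall fun i => ?_
      exact ((((Lp.aestronglyMeasurable (f i)).congr (hF i)).sub
        (Lp.aestronglyMeasurable g)).enorm.pow_const _)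
    · filter_upwards [hbd] with i hi
      filter_upwards [hi] with x hx
      gcongr
      exact enorm_le_iff_norm_le.2 hx
    · have := hb.2
      rw [h2] at this
      intro htop
      rw [htop] at this
      simp at this
    · filter_upwards [hlim] with x hx
      have h3 := (tendsto_sub_nhds_zero_iff.2 hx).enorm
      have h4 := ((ENNReal.continuous_rpow_const (y := 2)).tendsto _).comp h3
      simpa [Function.comp_def] using h4
  have h5 := ((ENNReal.continuous_rpow_const (y := 1 / 2)).tendsto _).comp h0
  simpa [Function.comp_def] using h5

end Multiplication

/-! ### The unitary group of a real multiplication operator -/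

section Group

variable {α : Type*} [MeasurableSpace α] {μ : Measure α} {p : α → ℝ}

theorem memLp_expI (hp : AEMeasurable p μ) (t : ℝ) :
    MemLp (fun x => Complex.exp (Complex.I * ((t * p x : ℝ) : ℂ))) ∞ μ := by
  refine memLp_top_of_bound ?_ 1 (Eventually.of_forall fun x => ?_)
  · exact (Complex.measurable_exp.comp_aemeasurable
      ((Complex.measurable_ofReal.comp_aemeasurable (hp.const_mul t)).const_mul _)
      ).aestronglyMeasurable
  · rw [mul_comm, Complex.norm_exp_ofReal_mul_I]

/-- Multiplication by `exp(i t p)`. -/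
def expMul (p : α → ℝ) (hp : AEMeasurable p μ) (t : ℝ) : Lp ℂ 2 μ →L[ℂ] Lp ℂ 2 μ :=
  mulL _ (memLp_expI hp t)

theorem coeFn_expMul (hp : AEMeasurable p μ) (t : ℝ) (f : Lp ℂ 2 μ) :
    expMul p hp t f =ᵐ[μ] fun x => Complex.exp (Complex.I * ((t * p x : ℝ) : ℂ)) * f x :=
  coeFn_mulL _ _ _

theorem isIsometricGroup_expMul (hp : AEMeasurable p μ) : IsIsometricGroup (expMul p hp) where
  zero f := mulL_eq_of_ae (by simp)
  add s t f := by
    refine mulL_eq_of_ae ?_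
    filter_upwards [coeFn_expMul hp s (expMul p hp t f), coeFn_expMul hp t f] with x h1 h2
    rw [h1, h2, ← mul_assoc, ← Complex.exp_add]
    push_cast; ring_nf
  norm t f := by
    refine le_antisymm ?_ ?_
    · simpa using Lp.norm_le_mul_norm_of_ae_le_mul (c := 1) (f := expMul p hp t f) (g := f) (by
        filter_upwards [coeFn_expMul hp t f] with x hx
        rw [hx, norm_mul, mul_comm Complex.I, Complex.norm_exp_ofReal_mul_I])
    · simpa using Lp.norm_le_mul_norm_of_ae_le_mul (c := 1) (f := f) (g := expMul p hp t f) (by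
        filter_upwards [coeFn_expMul hp t f] with x hx
        rw [hx, norm_mul, mul_comm Complex.I, Complex.norm_exp_ofReal_mul_I, one_mul, one_mul])
  cont f := by
    rw [continuous_iff_continuousAt]
    intro t
    refine tendsto_Lp_of_dominated
      (fun s x => Complex.exp (Complex.I * ((s * p x : ℝ) : ℂ)) * f x) (fun x => 2 * f x)
      (fun s => coeFn_expMul hp s f) ((Lp.memLp f).const_mul 2) (Eventually.of_forall fun s => ?_) ?_
    · filter_upwards [coeFn_expMul hp t f] with x hx
      rw [hx, ← sub_mul, norm_mul, norm_mul]
      gcongr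
      refine (norm_sub_le _ _).trans ?_
      rw [mul_comm Complex.I, mul_comm Complex.I, Complex.norm_exp_ofReal_mul_I,
        Complex.norm_exp_ofReal_mul_I]
      norm_num
    · filter_upwards [coeFn_expMul hp t f] with x hx
      rw [hx]
      have : Continuous fun s : ℝ => Complex.exp (Complex.I * ((s * p x : ℝ) : ℂ)) * f x := by
        fun_prop
      exact this.tendsto t

theorem hasDerivAt_expI (y : ℝ) (c : ℂ) :
    HasDerivAt (fun h : ℝ => Complex.exp (Complex.I * ((h * y : ℝ) : ℂ)) * c)
      (Complex.I * y * c) 0 := by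
  have h1 : HasDerivAt (fun h : ℝ => Complex.I * ((h * y : ℝ) : ℂ)) (Complex.I * (y : ℂ)) 0 := by
    have := ((hasDerivAt_id (0 : ℝ)).mul_const y).ofReal_comp.const_mul Complex.I
    simpa using this
  have h2 := h1.cexp.mul_const c
  simpa using h2

theorem coeFn_slope_expMul (hp : AEMeasurable p μ) (f : Lp ℂ 2 μ) (h : ℝ) :
    (h⁻¹ • (expMul p hp (0 + h) f - expMul p hp 0 f) : Lp ℂ 2 μ) =ᵐ[μ] fun x =>
      h⁻¹ • (Complex.exp (Complex.I * (((0 + h) * p x : ℝ) : ℂ)) * f x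
        - Complex.exp (Complex.I * ((0 * p x : ℝ) : ℂ)) * f x) := by
  filter_upwards [Lp.coeFn_smul h⁻¹ (expMul p hp (0 + h) f - expMul p hp 0 f),
    Lp.coeFn_sub (expMul p hp (0 + h) f) (expMul p hp 0 f), coeFn_expMul hp (0 + h) f,
    coeFn_expMul hp 0 f] with x h1 h2 h3 h4
  rw [h1, Pi.smul_apply, h2, Pi.sub_apply, h3, h4]

/-- The inequality |exp(ihp) - 1| ≤ |h||p| bounds every difference quotient by |g|, so dominated
convergence applies with majorant 2|g|. -/
theorem hasDerivAt_expMul_zero (hp : AEMeasurable p μ) {f g : Lp ℂ 2 μ}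
    (hg : g =ᵐ[μ] fun x => Complex.I * p x * f x) :
    HasDerivAt (fun t => expMul p hp t f) g 0 := by
  rw [hasDerivAt_iff_tendsto_slope_zero]
  refine tendsto_Lp_of_dominated (fun h x =>
      h⁻¹ • (Complex.exp (Complex.I * (((0 + h) * p x : ℝ) : ℂ)) * f x
        - Complex.exp (Complex.I * ((0 * p x : ℝ) : ℂ)) * f x))
    (fun x => 2 * g x) (coeFn_slope_expMul hp f)
    ((Lp.memLp g).const_mul 2) ?_ ?_
  · filter_upwards [self_mem_nhdsWithin] with h hh
    filter_upwards [hg] with x hx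
    have hh0 : 0 < |h| := abs_pos.2 hh
    have h1 : ‖Complex.exp (Complex.I * ((h * p x : ℝ) : ℂ)) - 1‖ ≤ |h| * |p x| :=
      Real.norm_exp_I_mul_ofReal_sub_one_le.trans_eq (by rw [Real.norm_eq_abs, abs_mul])
    have h2 : ‖h⁻¹ • (Complex.exp (Complex.I * (((0 + h) * p x : ℝ) : ℂ)) * f x
        - Complex.exp (Complex.I * ((0 * p x : ℝ) : ℂ)) * f x)‖ ≤ ‖g x‖ := by
      rw [hx, norm_smul, norm_inv, Real.norm_eq_abs, zero_add, zero_mul, Complex.ofReal_zero,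
        mul_zero, Complex.exp_zero, ← sub_mul, norm_mul, norm_mul, norm_mul, Complex.norm_I,
        one_mul, Complex.norm_real, Real.norm_eq_abs]
      calc |h|⁻¹ * (_ * ‖f x‖) ≤ |h|⁻¹ * ((|h| * |p x|) * ‖f x‖) := by gcongr
        _ = _ := by field_simp
    refine (norm_sub_le _ _).trans ?_
    rw [norm_mul, Complex.norm_ofNat]
    linarith
  · filter_upwards [hg] with x hx
    have h1 := hasDerivAt_iff_tendsto_slope_zero.1 (hasDerivAt_expI (p x) (f x))
    rw [← hx] at h1
    exact h1

theorem hasDerivAt_expMul (hp : AEMeasurable p μ) {f g : Lp ℂ 2 μ}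
    (hg : g =ᵐ[μ] fun x => Complex.I * p x * f x) (t : ℝ) :
    HasDerivAt (fun t => expMul p hp t f) (expMul p hp t g) t := by
  have h1 : HasDerivAt (fun h => expMul p hp h f) g (t - t) := by
    rw [sub_self]; exact hasDerivAt_expMul_zero hp hg
  have h2 := h1.comp_sub_const t t
  have h3 := (((expMul p hp t).restrictScalars ℝ).hasFDerivAt).comp_hasDerivAt t h2
  refine h3.congr_of_eventuallyEq (Eventually.of_forall fun s => ?_)
  change expMul p hp s f = expMul p hp t (expMul p hp (s - t) f)
  rw [← (isIsometricGroup_expMul hp).add]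
  congr 2; ring

/-- Convergence of the quotients in L² gives convergence almost everywhere along a sequence, and the
pointwise limit is i p f. In particular, differentiability of the orbit forces p f to lie in L². -/
theorem ae_eq_of_hasDerivAt_expMul (hp : AEMeasurable p μ) {f g : Lp ℂ 2 μ}
    (h : HasDerivAt (fun t => expMul p hp t f) g 0) :
    g =ᵐ[μ] fun x => Complex.I * p x * f x := by
  rw [hasDerivAt_iff_tendsto_slope_zero] at h
  obtain ⟨ns, hns, hae⟩ := (tendstoInMeasure_of_tendsto_Lp h).exists_seq_tendsto_ae'
  have hall : ∀ᵐ x ∂μ, ∀ n, _ := ae_all_iff.2 fun n => coeFn_slope_expMul hp f (ns n)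
  filter_upwards [hae, hall] with x h1 h2
  have h3 := (hasDerivAt_iff_tendsto_slope_zero.1 (hasDerivAt_expI (p x) (f x))).comp hns
  refine tendsto_nhds_unique h1 (h3.congr fun n => ?_)
  exact (h2 n).symm

end Group


/-! ### Translations, and the product rule on the Fourier side -/

section Translation

variable {d : ℕ}

/-- Translation `g ↦ g(· + a)` on `L²`. -/
def transl (a : Space d) : L2 d →L[ℂ] L2 d :=
  (Lp.compMeasurePreservingₗᵢ ℂ (fun x => x + a)
    (measurePreserving_add_right volume a)).toContinuousLinearMap

theorem coeFn_transl (a : Space d) (g : L2 d) : transl a g =ᵐ[volume] fun x => g (x + a) :=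
  Lp.coeFn_compMeasurePreserving g (measurePreserving_add_right volume a)

theorem transl_toLp (a : Space d) (f : SchwartzMap (Space d) ℂ) :
    transl a (f.toLp 2) = (f.compSubConstCLM ℂ (-a)).toLp 2 := by
  refine Lp.ext ?_
  have h0 : ∀ᵐ x, f.toLp 2 volume x = f x := f.coeFn_toLp 2 volume
  have h1 := (measurePreserving_add_right (volume : Measure (Space d)) a).quasiMeasurePreserving.ae
    h0
  filter_upwards [coeFn_transl a (f.toLp 2), h1, (f.compSubConstCLM ℂ (-a)).coeFn_toLp 2]
    with x h2 h3 h4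
  rw [h2, h3, h4, SchwartzMap.compSubConstCLM_apply, sub_neg_eq_add]

/-- The component of the angular frequency in the direction `e`. -/
def freqComp (e : Space d) (w : Space d) : ℝ := inner ℝ e (angular w)

theorem aemeasurable_freqComp (e : Space d) : AEMeasurable (freqComp e) volume := by
  have : Continuous (freqComp e) := by unfold freqComp angular; fun_prop
  exact this.measurable.aemeasurable

theorem fourier_comp_add (f : Space d → ℂ) (a w : Space d) :
    𝓕 (fun x => f (x + a)) w
      = Complex.exp (Complex.I * ((freqComp a w : ℝ) : ℂ)) * 𝓕 f w := by
  have h := congrFun (VectorFourier.fourierIntegral_comp_add_right Real.fourierChar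
    (volume : Measure (Space d)) (innerₗ (Space d)) f a) w
  refine h.trans ?_
  rw [Circle.smul_def, Real.fourierChar_apply, smul_eq_mul]
  congr 2
  simp only [freqComp, angular, innerₗ_apply_apply, inner_smul_right]
  push_cast; ring

/-- Both sides are continuous in g, so Schwartz functions suffice. Differentiability of translates
of g can then be read off from i(e·ξ)ĝ, and conversely. -/
theorem fourier_transl (e : Space d) (t : ℝ) (g : L2 d) :
    (𝓕 (transl (t • e) g) : L2 d) = expMul (freqComp e) (aemeasurable_freqComp e) t (𝓕 g) := by
  refine DenseRange.induction_on (p := fun g : L2 d => (𝓕 (transl (t • e) g) : L2 d)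
      = expMul (freqComp e) (aemeasurable_freqComp e) t (𝓕 g))
    (SchwartzMap.denseRange_toLpCLM (E := Space d) (F := ℂ) (p := 2) (μ := volume)
      ENNReal.ofNat_ne_top) g ?_ ?_
  · refine isClosed_eq ?_ ?_
    · exact (fourierCLM ℂ (L2 d)).continuous.comp (transl (t • e)).continuous
    · exact (expMul _ _ t).continuous.comp (fourierCLM ℂ (L2 d)).continuous
  · intro f
    rw [SchwartzMap.toLpCLM_apply, transl_toLp, SchwartzMap.toLp_fourier_eq,
      SchwartzMap.toLp_fourier_eq]
    symm
    refine mulL_eq_of_ae ?_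
    filter_upwards [(𝓕 (f.compSubConstCLM ℂ (-(t • e)))).coeFn_toLp 2 volume,
      (𝓕 f).coeFn_toLp 2 volume] with w h1 h2
    rw [h1, h2, SchwartzMap.fourier_coe, SchwartzMap.fourier_coe]
    have h3 : ⇑(f.compSubConstCLM ℂ (-(t • e))) = fun x => f (x + t • e) := by
      ext x; rw [SchwartzMap.compSubConstCLM_apply, sub_neg_eq_add]
    rw [h3, fourier_comp_add]
    congr 4
    simp [freqComp, inner_smul_left]

/-- The function `V` is bounded, and its difference quotients in the direction `e` converge
uniformly to the bounded function `V'`. -/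
structure HasUniformDeriv (e : Space d) (V V' : Space d → ℂ) : Prop where
  memLp : MemLp V ∞ volume
  memLp_deriv : MemLp V' ∞ volume
  tendsto : ∀ ε > 0, ∀ᶠ h in 𝓝[≠] (0 : ℝ), ∀ x, ‖h⁻¹ • (V (x + h • e) - V x) - V' x‖ ≤ ε

theorem memLp_comp_add {V : Space d → ℂ} (hV : MemLp V ∞ volume) (a : Space d) :
    MemLp (fun x => V (x + a)) ∞ volume :=
  hV.comp_measurePreserving (measurePreserving_add_right volume a)

/-- Leibniz rule for V g. A translate of V g is the translated multiplication operator applied to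
the translate of g. Uniform convergence of the quotients of V makes the operators differentiable in
operator norm, `hasDerivAt_expMul_zero` handles g, and `ae_eq_of_hasDerivAt_expMul` returns the
product rule to the Fourier side. -/
theorem HasUniformDeriv.fourier_mul {e : Space d} {V V' : Space d → ℂ} (h : HasUniformDeriv e V V')
    {g Dg : L2 d}
    (hD : (𝓕 Dg : L2 d) =ᵐ[volume] fun w => Complex.I * (freqComp e w : ℝ) * (𝓕 g : L2 d) w) :
    (𝓕 (mulL V' h.memLp_deriv g + mulL V h.memLp Dg) : L2 d) =ᵐ[volume]
      fun w => Complex.I * (freqComp e w : ℝ) * (𝓕 (mulL V h.memLp g) : L2 d) w := by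
  refine ae_eq_of_hasDerivAt_expMul (aemeasurable_freqComp e) ?_
  -- the translates of `g` are differentiable
  have hinv : ∀ t, transl (t • e) g
      = 𝓕⁻ (expMul (freqComp e) (aemeasurable_freqComp e) t (𝓕 g) : L2 d) := fun t => by
    rw [← fourier_transl, fourierInv_fourier_eq]
  have h1 : HasDerivAt (fun t : ℝ => transl (t • e) g) Dg 0 := by
    have h2 := (((fourierCLE ℂ (L2 d)).symm.toContinuousLinearMap.restrictScalars
      ℝ).hasFDerivAt).comp_hasDerivAt (0 : ℝ)
      (hasDerivAt_expMul_zero (aemeasurable_freqComp e) hD)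
    have h3 : (𝓕⁻ (𝓕 Dg : L2 d) : L2 d) = Dg := fourierInv_fourier_eq _
    refine (h2.congr_of_eventuallyEq (Eventually.of_forall fun t => hinv t)).congr_deriv h3
  -- the translates of the multiplication operator are differentiable
  let c : ℝ → L2 d →L[ℝ] L2 d := fun t =>
    (mulL (fun x => V (x + t • e)) (memLp_comp_add h.memLp _)).restrictScalars ℝ
  have hc : HasDerivAt c ((mulL V' h.memLp_deriv).restrictScalars ℝ) 0 := by
    rw [hasDerivAt_iff_tendsto_slope_zero, Metric.tendsto_nhds]
    intro ε hε
    filter_upwards [h.tendsto (ε / 2) (by positivity)] with r hr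
    rw [dist_eq_norm]
    refine lt_of_le_of_lt (ContinuousLinearMap.opNorm_le_bound _ (by positivity : 0 ≤ ε / 2)
      fun f => ?_) (by linarith)
    refine Lp.norm_le_mul_norm_of_ae_le_mul ?_
    have e1 : ((r⁻¹ • (c (0 + r) - c 0) - (mulL V' h.memLp_deriv).restrictScalars ℝ) f : L2 d)
      = r⁻¹ • (mulL (fun x => V (x + (0 + r) • e)) (memLp_comp_add h.memLp _) f
        - mulL (fun x => V (x + (0 : ℝ) • e)) (memLp_comp_add h.memLp _) f)
        - mulL V' h.memLp_deriv f := rfl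
    rw [e1]
    filter_upwards [coeFn_mulL _ (memLp_comp_add h.memLp ((0 + r) • e)) f,
      coeFn_mulL _ (memLp_comp_add h.memLp ((0 : ℝ) • e)) f, coeFn_mulL _ h.memLp_deriv f,
      Lp.coeFn_sub (r⁻¹ • (mulL (fun x => V (x + (0 + r) • e)) (memLp_comp_add h.memLp _) f
        - mulL (fun x => V (x + (0 : ℝ) • e)) (memLp_comp_add h.memLp _) f))
        (mulL V' h.memLp_deriv f),
      Lp.coeFn_smul r⁻¹ (mulL (fun x => V (x + (0 + r) • e)) (memLp_comp_add h.memLp _) f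
        - mulL (fun x => V (x + (0 : ℝ) • e)) (memLp_comp_add h.memLp _) f),
      Lp.coeFn_sub (mulL (fun x => V (x + (0 + r) • e)) (memLp_comp_add h.memLp _) f)
        (mulL (fun x => V (x + (0 : ℝ) • e)) (memLp_comp_add h.memLp _) f)] with x k1 k2 k3 k4 k5 k6
    rw [k4, Pi.sub_apply, k5, Pi.smul_apply, k6, Pi.sub_apply, k1, k2, k3, zero_smul, add_zero,
      zero_add, ← sub_mul, ← smul_mul_assoc, ← sub_mul, norm_mul]
    gcongr
    exact hr x
  have hprod := hc.clm_apply h1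
  have hcT : ∀ t, c t (transl (t • e) g) = transl (t • e) (mulL V h.memLp g) := by
    intro t
    refine mulL_eq_of_ae ?_
    have h4 := (measurePreserving_add_right (volume : Measure (Space d))
      (t • e)).quasiMeasurePreserving.ae (coeFn_mulL V h.memLp g)
    filter_upwards [coeFn_transl (t • e) (mulL V h.memLp g), coeFn_transl (t • e) g, h4]
      with x k1 k2 k3
    rw [k1, k2, k3]
  have h0 : transl ((0 : ℝ) • e) g = g := by
    rw [hinv, (isIsometricGroup_expMul _).zero, fourierInv_fourier_eq]
  have hc0 : c 0 Dg = mulL V h.memLp Dg := by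
    refine mulL_eq_of_ae ?_
    filter_upwards [coeFn_mulL V h.memLp Dg] with x hx
    rw [hx]; simp
  have h5 : HasDerivAt (fun t : ℝ => transl (t • e) (mulL V h.memLp g))
      (mulL V' h.memLp_deriv g + mulL V h.memLp Dg) 0 := by
    refine (hprod.congr_of_eventuallyEq (Eventually.of_forall fun t => (hcT t).symm)).congr_deriv ?_
    rw [h0, hc0]; rfl
  have h6 := (((fourierCLM ℂ (L2 d)).restrictScalars ℝ).hasFDerivAt).comp_hasDerivAt (0 : ℝ) h5
  exact h6.congr_of_eventuallyEq (Eventually.of_forall fun t => (fourier_transl e t _).symm)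

end Translation


/-! ### Convolution of a Schwartz function with an integrable function -/

section Convolution

variable {d : ℕ}

/-- The convolution `κ * f`. -/
def conv (κ : SchwartzMap (Space d) ℂ) (f : Space d → ℂ) (x : Space d) : ℂ :=
  ∫ y, κ (x - y) * f y

/-- The sum of the sup norms of the derivatives of `κ` up to order `s`. -/
def supNorm (s : ℕ) (κ : SchwartzMap (Space d) ℂ) : ℝ :=
  ∑ k ∈ Finset.range (s + 1), SchwartzMap.seminorm ℝ 0 k κ

theorem supNorm_nonneg (s : ℕ) (κ : SchwartzMap (Space d) ℂ) : 0 ≤ supNorm s κ :=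
  Finset.sum_nonneg fun _ _ => apply_nonneg _ _

theorem norm_le_supNorm (s : ℕ) (κ : SchwartzMap (Space d) ℂ) (x : Space d) :
    ‖κ x‖ ≤ supNorm s κ :=
  (SchwartzMap.norm_le_seminorm ℝ κ x).trans
    (Finset.single_le_sum (f := fun k => SchwartzMap.seminorm ℝ 0 k κ)
      (fun _ _ => apply_nonneg _ _) (Finset.mem_range.2 (Nat.succ_pos s)))

theorem supNorm_le_succ (s : ℕ) (κ : SchwartzMap (Space d) ℂ) :
    supNorm s κ ≤ supNorm (s + 1) κ := by
  unfold supNorm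
  rw [Finset.sum_range_succ _ (s + 1)]
  linarith [apply_nonneg (SchwartzMap.seminorm ℝ 0 (s + 1)) κ]

theorem supNorm_lineDeriv_le (s : ℕ) (κ : SchwartzMap (Space d) ℂ) {e : Space d} (he : ‖e‖ ≤ 1) :
    supNorm s (∂_{e} κ) ≤ supNorm (s + 1) κ := by
  have h : ∀ k, SchwartzMap.seminorm ℝ 0 k (∂_{e} κ) ≤ SchwartzMap.seminorm ℝ 0 (k + 1) κ := by
    intro k
    refine SchwartzMap.seminorm_le_bound ℝ 0 k _ (apply_nonneg _ _) fun x => ?_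
    rw [pow_zero, one_mul]
    have h1 : ⇑(∂_{e} κ : SchwartzMap (Space d) ℂ) = fun y => fderiv ℝ κ y e := rfl
    have h2 : ContDiffAt ℝ k (fderiv ℝ κ) x := by
      exact ((κ.smooth (k + 1)).fderiv_right (m := k) le_rfl).contDiffAt
    rw [h1]
    calc _ ≤ ‖e‖ * ‖iteratedFDeriv ℝ k (fderiv ℝ κ) x‖ :=
          norm_iteratedFDeriv_clm_apply_const h2 le_rfl
      _ ≤ 1 * ‖iteratedFDeriv ℝ (k + 1) κ x‖ := by
          rw [norm_iteratedFDeriv_fderiv]; gcongr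
      _ ≤ _ := by rw [one_mul]; exact SchwartzMap.norm_iteratedFDeriv_le_seminorm ℝ κ (k + 1) x
  unfold supNorm
  rw [Finset.sum_range_succ' _ (s + 1)]
  have := apply_nonneg (SchwartzMap.seminorm ℝ 0 0) κ
  have h3 := Finset.sum_le_sum fun k (_ : k ∈ Finset.range (s + 1)) => h k
  linarith

theorem integrable_conv (κ : SchwartzMap (Space d) ℂ) {f : Space d → ℂ} (hf : Integrable f)
    (x : Space d) : Integrable fun y => κ (x - y) * f y :=
  hf.bdd_mul (c := supNorm 0 κ)
    (by have := κ.continuous; exact Continuous.aestronglyMeasurable (by fun_prop))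
    (Eventually.of_forall fun y => norm_le_supNorm 0 κ _)

theorem norm_conv_le (s : ℕ) (κ : SchwartzMap (Space d) ℂ) {f : Space d → ℂ} (hf : Integrable f)
    (x : Space d) : ‖conv κ f x‖ ≤ supNorm s κ * ∫ y, ‖f y‖ := by
  rw [← integral_const_mul]
  refine (norm_integral_le_integral_norm _).trans
    (integral_mono (integrable_conv κ hf x).norm (hf.norm.const_mul _) fun y => ?_)
  change ‖κ (x - y) * f y‖ ≤ _
  rw [norm_mul]
  gcongr
  exact norm_le_supNorm s κ _

theorem continuous_conv (κ : SchwartzMap (Space d) ℂ) {f : Space d → ℂ} (hf : Integrable f) :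
    Continuous (conv κ f) := by
  refine continuous_of_dominated (bound := fun y => supNorm 0 κ * ‖f y‖)
    (fun x => (integrable_conv κ hf x).aestronglyMeasurable)
    (fun x => Eventually.of_forall fun y => ?_) (hf.norm.const_mul _)
    (Eventually.of_forall fun y => ?_)
  · rw [norm_mul]
    gcongr
    exact norm_le_supNorm 0 κ _
  · have := κ.continuous
    fun_prop

theorem memLp_conv (κ : SchwartzMap (Space d) ℂ) {f : Space d → ℂ} (hf : Integrable f) :
    MemLp (conv κ f) ∞ volume :=
  memLp_top_of_bound (continuous_conv κ hf).aestronglyMeasurable _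
    (Eventually.of_forall (norm_conv_le 0 κ hf))

theorem hasDerivAt_line (κ : SchwartzMap (Space d) ℂ) (e z : Space d) (t : ℝ) :
    HasDerivAt (fun t : ℝ => κ (z + t • e)) (∂_{e} κ (z + t • e)) t := by
  have h1 : HasDerivAt (fun t : ℝ => z + t • e) e t := by
    simpa using ((hasDerivAt_id t).smul_const e).const_add z
  exact (κ.hasFDerivAt (z + t • e)).comp_hasDerivAt t h1

theorem norm_sub_line_le (κ : SchwartzMap (Space d) ℂ) (e z : Space d) (h : ℝ) :
    ‖κ (z + h • e) - κ z‖ ≤ supNorm 0 (∂_{e} κ) * |h| := by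
  have := convex_univ.norm_image_sub_le_of_norm_hasDerivWithin_le
    (f := fun t : ℝ => κ (z + t • e)) (C := supNorm 0 (∂_{e} κ)) (x := 0) (y := h)
    (fun t _ => (hasDerivAt_line κ e z t).hasDerivWithinAt)
    (fun t _ => norm_le_supNorm 0 _ _) (mem_univ _) (mem_univ _)
  simpa using this

/-- Mean value inequality for t ↦ κ(z + te) - t ∂κ(z), whose derivative is O(|t|) by
`norm_sub_line_le`. The constant does not depend on z, which makes the quotients of κ * f converge
uniformly. -/
theorem norm_taylor_line_le (κ : SchwartzMap (Space d) ℂ) (e z : Space d) (h : ℝ) :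
    ‖κ (z + h • e) - κ z - h • ∂_{e} κ z‖ ≤ supNorm 0 (∂_{e} (∂_{e} κ)) * |h| * |h| := by
  have := (convex_uIcc (0 : ℝ) h).norm_image_sub_le_of_norm_hasDerivWithin_le
    (f := fun t : ℝ => κ (z + t • e) - t • ∂_{e} κ z)
    (f' := fun t => ∂_{e} κ (z + t • e) - ∂_{e} κ z)
    (C := supNorm 0 (∂_{e} (∂_{e} κ)) * |h|) (x := 0) (y := h)
    (fun t _ => ((hasDerivAt_line κ e z t).sub (by
      simpa using (hasDerivAt_id t).smul_const (∂_{e} κ z))).hasDerivWithinAt)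
    (fun t ht => (norm_sub_line_le (∂_{e} κ) e z t).trans (by
      have h1 : |t| ≤ |h| := by simpa using abs_sub_left_of_mem_uIcc ht
      have := supNorm_nonneg 0 (∂_{e} (∂_{e} κ))
      gcongr)) left_mem_uIcc right_mem_uIcc
  have e1 : κ (z + h • e) - κ z - h • ∂_{e} κ z
      = (κ (z + h • e) - h • ∂_{e} κ z) - (κ (z + (0 : ℝ) • e) - (0 : ℝ) • ∂_{e} κ z) := by
    simp only [zero_smul, add_zero, sub_zero]; ring
  rw [e1]
  simpa using this

theorem hasUniformDeriv_conv (κ : SchwartzMap (Space d) ℂ) (e : Space d) {f : Space d → ℂ}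
    (hf : Integrable f) : HasUniformDeriv e (conv κ f) (conv (∂_{e} κ) f) where
  memLp := memLp_conv κ hf
  memLp_deriv := memLp_conv _ hf
  tendsto ε hε := by
    set C := supNorm 0 (∂_{e} (∂_{e} κ)) with hC
    have hC0 : 0 ≤ C := supNorm_nonneg _ _
    have hcont : Tendsto (fun h : ℝ => C * |h| * ∫ y, ‖f y‖) (𝓝[≠] 0) (𝓝 0) := by
      have : Continuous fun h : ℝ => C * |h| * ∫ y, ‖f y‖ := by fun_prop
      have h2 := this.tendsto 0
      simp only [abs_zero, mul_zero, zero_mul] at h2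
      exact h2.mono_left nhdsWithin_le_nhds
    filter_upwards [hcont.eventually_le_const hε, self_mem_nhdsWithin] with h hh hne x
    have hh0 : 0 < |h| := abs_pos.2 hne
    refine le_trans ?_ hh
    have i1 := integrable_conv κ hf (x + h • e)
    have i2 := integrable_conv κ hf x
    have i3 := integrable_conv (∂_{e} κ) hf x
    have e1 : h⁻¹ • (conv κ f (x + h • e) - conv κ f x) - conv (∂_{e} κ) f x
        = ∫ y, (h⁻¹ • (κ (x + h • e - y) * f y - κ (x - y) * f y) - ∂_{e} κ (x - y) * f y) := by
      rw [integral_sub _ i3, integral_smul, integral_sub i1 i2]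
      · rfl
      · exact (i1.sub i2).smul h⁻¹
    rw [e1, ← integral_const_mul]
    refine norm_integral_le_of_norm_le (hf.norm.const_mul _) (Eventually.of_forall fun y => ?_)
    have e2 : h⁻¹ • (κ (x + h • e - y) * f y - κ (x - y) * f y) - ∂_{e} κ (x - y) * f y
        = h⁻¹ • ((κ (x - y + h • e) - κ (x - y) - h • ∂_{e} κ (x - y)) * f y) := by
      rw [show x + h • e - y = x - y + h • e by abel, sub_mul, sub_mul, smul_sub h⁻¹ (_ - _),
        smul_mul_assoc, inv_smul_smul₀ hne]
    rw [e2, norm_smul, norm_mul, norm_inv, Real.norm_eq_abs]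
    calc |h|⁻¹ * (‖κ (x - y + h • e) - κ (x - y) - h • ∂_{e} κ (x - y)‖ * ‖f y‖)
        ≤ |h|⁻¹ * ((C * |h| * |h|) * ‖f y‖) := by
          gcongr; exact norm_taylor_line_le κ e _ h
      _ = _ := by field_simp

end Convolution

/-! ### The weighted norms on the Fourier side -/

section Weighted

variable {d : ℕ}

/-- `∫ (1 + |ξ|²)^s |h|²`, as an extended nonnegative real. -/
def hsEnergy (s : ℕ) (h : Space d → ℂ) : ℝ≥0∞ :=
  ∫⁻ w, ENNReal.ofReal ((1 + ‖angular w‖ ^ 2) ^ s) * ‖h w‖ₑ ^ 2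

theorem continuous_angular : Continuous (angular : Space d → Space d) := by
  unfold angular; fun_prop

theorem measurable_weight (s : ℕ) :
    Measurable fun w : Space d => ENNReal.ofReal ((1 + ‖angular w‖ ^ 2) ^ s) := by
  have := continuous_angular (d := d)
  exact ENNReal.measurable_ofReal.comp (Continuous.measurable (by fun_prop))

theorem aemeasurable_hsEnergy (s : ℕ) {h : Space d → ℂ} (hh : AEStronglyMeasurable h volume) :
    AEMeasurable (fun w => ENNReal.ofReal ((1 + ‖angular w‖ ^ 2) ^ s) * ‖h w‖ₑ ^ 2) volume :=
  (measurable_weight s).aemeasurable.mul (hh.enorm.pow_const 2)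

theorem hsEnergy_congr {s : ℕ} {h k : Space d → ℂ} (hk : h =ᵐ[volume] k) :
    hsEnergy s h = hsEnergy s k := by
  refine lintegral_congr_ae ?_
  filter_upwards [hk] with w hw
  rw [hw]

theorem hsEnergy_add_le (s : ℕ) {h k : Space d → ℂ} (hh : AEStronglyMeasurable h volume) :
    hsEnergy s (fun w => h w + k w) ≤ 2 * hsEnergy s h + 2 * hsEnergy s k := by
  unfold hsEnergy
  rw [← lintegral_const_mul' _ _ (by norm_num), ← lintegral_const_mul' _ _ (by norm_num),
    ← lintegral_add_left' ((aemeasurable_hsEnergy s hh).const_mul 2)]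
  refine lintegral_mono fun w => ?_
  have h1 : ‖h w + k w‖ₑ ^ 2 ≤ 2 * ‖h w‖ₑ ^ 2 + 2 * ‖k w‖ₑ ^ 2 := by
    have h2 : ‖h w + k w‖ ^ 2 ≤ 2 * ‖h w‖ ^ 2 + 2 * ‖k w‖ ^ 2 := by
      have := norm_add_le (h w) (k w)
      nlinarith [norm_nonneg (h w), norm_nonneg (k w), norm_nonneg (h w + k w),
        sq_nonneg (‖h w‖ - ‖k w‖)]
    simp only [← ofReal_norm]
    rw [← ENNReal.ofReal_pow (norm_nonneg _), ← ENNReal.ofReal_pow (norm_nonneg _),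
      ← ENNReal.ofReal_pow (norm_nonneg _),
      show (2 : ℝ≥0∞) = ENNReal.ofReal 2 by simp, ← ENNReal.ofReal_mul (by norm_num),
      ← ENNReal.ofReal_mul (by norm_num), ← ENNReal.ofReal_add (by positivity) (by positivity)]
    exact ENNReal.ofReal_le_ofReal h2
  calc _ ≤ ENNReal.ofReal ((1 + ‖angular w‖ ^ 2) ^ s) * (2 * ‖h w‖ₑ ^ 2 + 2 * ‖k w‖ₑ ^ 2) := by
        gcongr
    _ = _ := by ring

/-- The `j`-th vector of the standard basis. -/
abbrev stdVec (j : Fin d) : Space d := EuclideanSpace.single j (1 : ℝ)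

/-- From 1 + |ξ|² = 1 + Σ ξ_j²: one order of regularity is traded for one derivative in each
coordinate direction, which drives the induction on s. -/
theorem hsEnergy_succ (s : ℕ) {h : Space d → ℂ} (hh : AEStronglyMeasurable h volume) :
    hsEnergy (s + 1) h = hsEnergy s h
      + ∑ j : Fin d, hsEnergy s (fun w => Complex.I * (freqComp (stdVec j) w : ℝ) * h w) := by
  unfold hsEnergy
  rw [← lintegral_finsetSum', ← lintegral_add_left' (aemeasurable_hsEnergy s hh)]
  · refine lintegral_congr fun w => ?_
    have h1 : ∀ j : Fin d, ‖Complex.I * (freqComp (stdVec j) w : ℝ) * h w‖ₑ ^ 2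
        = ENNReal.ofReal ((angular w j) ^ 2) * ‖h w‖ₑ ^ 2 := fun j => by
      have : freqComp (stdVec j) w = angular w j := by
        simp [freqComp, stdVec, EuclideanSpace.inner_single_left]
      rw [this, enorm_mul, mul_pow, ← ofReal_norm (Complex.I * _), norm_mul,
        Complex.norm_I, one_mul, Complex.norm_real, Real.norm_eq_abs,
        ← ENNReal.ofReal_pow (abs_nonneg _), sq_abs]
    simp only [h1]
    rw [← Finset.mul_sum, ← Finset.sum_mul, ← ENNReal.ofReal_sum_of_nonneg fun _ _ => sq_nonneg _,
      ← EuclideanSpace.real_norm_sq_eq, pow_succ, ENNReal.ofReal_mul (by positivity),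
      ENNReal.ofReal_add zero_le_one (by positivity), ENNReal.ofReal_one]
    ring
  · intro j _
    refine aemeasurable_hsEnergy s (AEStronglyMeasurable.mul ?_ hh)
    exact ((Complex.measurable_ofReal.comp_aemeasurable
      (aemeasurable_freqComp (stdVec j))).const_mul _).aestronglyMeasurable

theorem hsEnergy_zero_eq (h : Space d → ℂ) : hsEnergy 0 h = eLpNorm h 2 volume ^ 2 := by
  rw [eLpNorm_eq_lintegral_rpow_enorm_toReal (by norm_num) (by norm_num), ← ENNReal.rpow_natCast,
    ← ENNReal.rpow_mul]
  simp [hsEnergy]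

theorem hsEnergy_mono (s : ℕ) (h : Space d → ℂ) : hsEnergy 0 h ≤ hsEnergy s h := by
  refine lintegral_mono fun w => ?_
  gcongr
  · nlinarith [sq_nonneg ‖angular w‖]
  · exact Nat.zero_le s

/-- Induction on s, with κ and g free because Leibniz' rule calls for the bound with ∂_jκ and with
∂_jg. All derivatives of the product κ * f fall on κ, so f enters only through its L¹ norm. Order 0
is Plancherel's identity. -/
theorem hsEnergy_fourier_conv_le (s : ℕ) (κ : SchwartzMap (Space d) ℂ) {f : Space d → ℂ}
    (hf : Integrable f) (g : L2 d) (hg : hsEnergy s (𝓕 g : L2 d) < ∞) :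
    hsEnergy s (𝓕 (mulL (conv κ f) (memLp_conv κ hf) g) : L2 d)
      ≤ ENNReal.ofReal ((2 + 2 * d) ^ s * (supNorm s κ * ∫ y, ‖f y‖) ^ 2)
        * hsEnergy s (𝓕 g : L2 d) := by
  induction s generalizing κ g with
  | zero =>
    have hnorm : ∀ k : L2 d, hsEnergy 0 (𝓕 k : L2 d) = ENNReal.ofReal (‖k‖ ^ 2) := fun k => by
      rw [hsEnergy_zero_eq, ← Lp.enorm_def, ← ofReal_norm, Lp.norm_fourier_eq,
        ENNReal.ofReal_pow (norm_nonneg _)]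
    rw [hnorm, hnorm, ← ENNReal.ofReal_mul (by positivity), pow_zero, one_mul, ← mul_pow]
    refine ENNReal.ofReal_le_ofReal ?_
    gcongr
    exact norm_mulL_apply_le _ (Eventually.of_forall (norm_conv_le 0 κ hf)) g
  | succ s ih =>
    have hm : ∀ k : L2 d, AEStronglyMeasurable k volume := fun k => Lp.aestronglyMeasurable k
    have hsucc := hsEnergy_succ s (hm (𝓕 g : L2 d))
    have hg0 : hsEnergy s (𝓕 g : L2 d) < ∞ := lt_of_le_of_lt (by rw [hsucc]; exact le_self_add) hg
    have hgj : ∀ j : Fin d, hsEnergy s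
        (fun w => Complex.I * (freqComp (stdVec j) w : ℝ) * (𝓕 g : L2 d) w) < ∞ := fun j => by
      refine lt_of_le_of_lt ?_ hg
      rw [hsucc]
      exact (Finset.single_le_sum (f := fun j : Fin d => hsEnergy s
        (fun w => Complex.I * (freqComp (stdVec j) w : ℝ) * (𝓕 g : L2 d) w))
        (fun _ _ => zero_le) (Finset.mem_univ j)).trans le_add_self
    set Q : ℝ := supNorm (s + 1) κ * ∫ y, ‖f y‖ with hQ
    set A : ℝ := (2 + 2 * d) ^ s * Q ^ 2 with hA
    have hf0 : 0 ≤ ∫ y, ‖f y‖ := integral_nonneg fun _ => norm_nonneg _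
    have hA0 : 0 ≤ A := by positivity
    have hmono : ∀ κ' : SchwartzMap (Space d) ℂ, supNorm s κ' ≤ supNorm (s + 1) κ →
        ENNReal.ofReal ((2 + 2 * d) ^ s * (supNorm s κ' * ∫ y, ‖f y‖) ^ 2) ≤ ENNReal.ofReal A := by
      intro κ' hκ'
      have := supNorm_nonneg s κ'
      refine ENNReal.ofReal_le_ofReal ?_
      rw [hA, hQ]; gcongr
    have h1 := (ih κ g hg0).trans (mul_le_mul_left (hmono κ (supNorm_le_succ s κ)) _)
    have h2 : ∀ j : Fin d, hsEnergy s (fun w => Complex.I * (freqComp (stdVec j) w : ℝ)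
          * (𝓕 (mulL (conv κ f) (memLp_conv κ hf) g) : L2 d) w)
        ≤ ENNReal.ofReal A * (2 * hsEnergy s (𝓕 g : L2 d) + 2 * hsEnergy s
          (fun w => Complex.I * (freqComp (stdVec j) w : ℝ) * (𝓕 g : L2 d) w)) := by
      intro j
      have hmem : MemLp (fun w => Complex.I * (freqComp (stdVec j) w : ℝ) * (𝓕 g : L2 d) w) 2
          volume := by
        refine ⟨AEStronglyMeasurable.mul ((Complex.measurable_ofReal.comp_aemeasurable
          (aemeasurable_freqComp (stdVec j))).const_mul _).aestronglyMeasurable (hm _), ?_⟩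
        have := (hsEnergy_mono s _).trans_lt (hgj j)
        rw [hsEnergy_zero_eq] at this
        simpa using this
      -- `Dg` is ∂_j g, defined by its Fourier transform; finiteness of the energy of g puts it in
      -- L².
      set Dg : L2 d := 𝓕⁻ (hmem.toLp _ : L2 d) with hDg
      have hDg' : (𝓕 Dg : L2 d) =ᵐ[volume]
          fun w => Complex.I * (freqComp (stdVec j) w : ℝ) * (𝓕 g : L2 d) w := by
        rw [hDg, fourier_fourierInv_eq]
        exact hmem.coeFn_toLp
      have hleib := (hasUniformDeriv_conv κ (stdVec j) hf).fourier_mul hDg'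
      rw [← hsEnergy_congr hDg', ← hsEnergy_congr hleib]
      have hadd : (𝓕 (mulL (conv (∂_{stdVec j} κ) f) (memLp_conv _ hf) g
            + mulL (conv κ f) (memLp_conv κ hf) Dg) : L2 d) =ᵐ[volume]
          fun w => (𝓕 (mulL (conv (∂_{stdVec j} κ) f) (memLp_conv _ hf) g) : L2 d) w
            + (𝓕 (mulL (conv κ f) (memLp_conv κ hf) Dg) : L2 d) w := by
        rw [FourierTransform.fourier_add]
        exact Lp.coeFn_add _ _
      refine (hsEnergy_congr hadd).trans_le ((hsEnergy_add_le s (hm _)).trans ?_)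
      have hj1 : ‖(stdVec j : Space d)‖ ≤ 1 := by simp
      have k1 := (ih (∂_{stdVec j} κ) g hg0).trans
        (mul_le_mul_left (hmono _ (supNorm_lineDeriv_le s κ hj1)) _)
      have k2 := (ih κ Dg (by rw [hsEnergy_congr hDg']; exact hgj j)).trans
        (mul_le_mul_left (hmono κ (supNorm_le_succ s κ)) _)
      calc _ ≤ 2 * (ENNReal.ofReal A * hsEnergy s (𝓕 g : L2 d))
            + 2 * (ENNReal.ofReal A * hsEnergy s (𝓕 Dg : L2 d)) := by gcongr
        _ = _ := by ring
    rw [hsEnergy_succ s (hm _)]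
    have h3 := Finset.sum_le_sum fun j (_ : j ∈ Finset.univ) => h2 j
    rw [← Finset.mul_sum, Finset.sum_add_distrib, Finset.sum_const, ← Finset.mul_sum,
      Finset.card_univ, Fintype.card_fin] at h3
    refine (add_le_add h1 h3).trans ?_
    have h4 : (2 + 2 * (d : ℝ)) ^ (s + 1) * Q ^ 2 = A * (2 + 2 * d) := by rw [hA]; ring
    clear_value A
    rw [h4, ENNReal.ofReal_mul hA0, ENNReal.ofReal_add (by norm_num) (by positivity),
      ENNReal.ofReal_mul (by norm_num), ENNReal.ofReal_natCast, hsucc, ← mul_add, mul_assoc]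
    simp only [ENNReal.ofReal_ofNat, nsmul_eq_mul]
    gcongr
    set X := hsEnergy s (𝓕 g : L2 d)
    set Y := ∑ j : Fin d, hsEnergy s
        (fun w => Complex.I * (freqComp (stdVec j) w : ℝ) * (𝓕 g : L2 d) w)
    -- The 2's come from |a + b|² ≤ 2|a|² + 2|b|². The total (1 + 2d)X + 2Y is at most (2 + 2d)(X +
    -- Y), hence the factor 2 + 2d per order.
    calc X + (d * (2 * X) + 2 * Y) ≤ X + (d * (2 * X) + 2 * Y) + (X + 2 * d * Y) := le_self_add
      _ = _ := by ring

end Weighted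


/-! ### Sobolev spaces as ranges of Bessel potentials -/

section Sobolev

variable {d : ℕ}

/-- The conjugate `𝓕⁻ T 𝓕` of an operator by the Fourier transform. -/
def fourierConj (T : L2 d →L[ℂ] L2 d) : L2 d →L[ℂ] L2 d :=
  (fourierCLE ℂ (L2 d)).symm.toContinuousLinearMap ∘L T ∘L
    (fourierCLE ℂ (L2 d)).toContinuousLinearMap

theorem fourierConj_apply (T : L2 d →L[ℂ] L2 d) (f : L2 d) :
    fourierConj T f = 𝓕⁻ (T (𝓕 f) : L2 d) := rfl

theorem fourier_fourierConj (T : L2 d →L[ℂ] L2 d) (f : L2 d) :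
    (𝓕 (fourierConj T f) : L2 d) = T (𝓕 f) := by
  rw [fourierConj_apply, fourier_fourierInv_eq]

/-- The symbol `(1 + |ξ|²)^{-s/2}`. -/
def besselSymbol (s : ℕ) (w : Space d) : ℂ :=
  (((1 + ‖angular w‖ ^ 2) ^ (-((s : ℝ) / 2)) : ℝ) : ℂ)

theorem norm_besselSymbol_le (s : ℕ) (w : Space d) : ‖besselSymbol s w‖ ≤ 1 := by
  rw [besselSymbol, Complex.norm_real, Real.norm_of_nonneg (by positivity)]
  exact Real.rpow_le_one_of_one_le_of_nonpos (by nlinarith [sq_nonneg ‖angular w‖])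
    (by have := s.cast_nonneg (α := ℝ); linarith)

theorem memLp_besselSymbol (s : ℕ) : MemLp (besselSymbol s : Space d → ℂ) ∞ volume := by
  refine memLp_top_of_bound ?_ 1 (Eventually.of_forall (norm_besselSymbol_le s))
  have : Continuous fun w : Space d => (1 + ‖angular w‖ ^ 2) ^ (-((s : ℝ) / 2)) :=
    Continuous.rpow_const (by have := continuous_angular (d := d); fun_prop) fun w => Or.inl (by positivity)
  exact (Complex.continuous_ofReal.comp this).aestronglyMeasurable

/-- The Bessel potential `(1 - Δ)^{-s/2}`. -/
def bessel (s : ℕ) : L2 d →L[ℂ] L2 d :=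
  fourierConj (mulL (besselSymbol s) (memLp_besselSymbol s))

theorem weight_mul_besselSymbol (s : ℕ) (w : Space d) :
    (((1 + ‖angular w‖ ^ 2) ^ ((s : ℝ) / 2) : ℝ) : ℂ) * besselSymbol s w = 1 := by
  rw [besselSymbol, ← Complex.ofReal_mul, ← Real.rpow_add (by positivity), add_neg_cancel,
    Real.rpow_zero, Complex.ofReal_one]

theorem besselMul_bessel (s : ℕ) (g : L2 d) :
    besselMul s (bessel s g) =ᵐ[volume] (𝓕 g : L2 d) := by
  unfold besselMul bessel
  rw [fourier_fourierConj]
  filter_upwards [coeFn_mulL (besselSymbol s) (memLp_besselSymbol s) (𝓕 g)] with w hw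
  rw [hw, ← mul_assoc, weight_mul_besselSymbol, one_mul]

theorem memHs_bessel (s : ℕ) (g : L2 d) : MemHs s (bessel s g) :=
  (memLp_congr_ae (besselMul_bessel s g)).2 (Lp.memLp _)

/-- Together with `bessel_besselInv`, this makes `bessel s` an isometry of L² onto H^s, so that H^s
estimates become estimates on preimages in L². -/
theorem hsNorm_bessel (s : ℕ) (g : L2 d) : hsNorm s (bessel s g) = ‖g‖ := by
  rw [hsNorm, eLpNorm_congr_ae (besselMul_bessel s g), ← Lp.norm_def, Lp.norm_fourier_eq]

theorem bessel_injective (s : ℕ) : Function.Injective (bessel s : L2 d → L2 d) := by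
  refine (injective_iff_map_eq_zero (bessel s)).2 fun g hg => ?_
  rw [← norm_eq_zero, ← hsNorm_bessel s g, hg, ← map_zero (bessel s), hsNorm_bessel, norm_zero]

theorem norm_bessel_le (s : ℕ) (g : L2 d) : ‖bessel s g‖ ≤ ‖g‖ := by
  have h := norm_mulL_apply_le (memLp_besselSymbol s)
    (Eventually.of_forall (norm_besselSymbol_le s)) (𝓕 g : L2 d)
  rw [one_mul, Lp.norm_fourier_eq] at h
  rwa [← Lp.norm_fourier_eq, bessel, fourier_fourierConj]

/-- The preimage of a function in `H^s` under the Bessel potential. -/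
def besselInv (s : ℕ) (f : L2 d) (hf : MemHs s f) : L2 d :=
  𝓕⁻ (MemLp.toLp (besselMul s f) hf : L2 d)

theorem bessel_besselInv (s : ℕ) (f : L2 d) (hf : MemHs s f) : bessel s (besselInv s f hf) = f := by
  have h : mulL (besselSymbol s) (memLp_besselSymbol s) (MemLp.toLp (besselMul s f) hf)
      = (𝓕 f : L2 d) := by
    refine mulL_eq_of_ae ?_
    filter_upwards [hf.coeFn_toLp] with w hw
    rw [hw, besselMul, ← mul_assoc, mul_comm (besselSymbol s w), weight_mul_besselSymbol, one_mul]
  rw [bessel, fourierConj_apply, besselInv, fourier_fourierInv_eq, h, fourierInv_fourier_eq]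

theorem bessel_zero (g : L2 d) : bessel 0 g = g := by
  have h : mulL (besselSymbol 0) (memLp_besselSymbol 0) (𝓕 g : L2 d) = 𝓕 g :=
    mulL_eq_of_ae (by simp [besselSymbol])
  rw [bessel, fourierConj_apply, h, fourierInv_fourier_eq]

theorem eLpNorm_besselMul_sq (s : ℕ) (f : L2 d) :
    eLpNorm (besselMul s f) 2 volume ^ 2 = hsEnergy s (𝓕 f : L2 d) := by
  rw [← hsEnergy_zero_eq]
  refine lintegral_congr fun w => ?_
  have h : ((1 + ‖angular w‖ ^ 2) ^ ((s : ℝ) / 2)) ^ 2 = (1 + ‖angular w‖ ^ 2) ^ s := by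
    rw [← Real.rpow_natCast (_ ^ ((s : ℝ) / 2)) 2, ← Real.rpow_mul (by positivity),
      ← Real.rpow_natCast _ s]
    congr 1
    push_cast; ring
  rw [pow_zero, ENNReal.ofReal_one, one_mul, besselMul, enorm_mul, mul_pow, ← ofReal_norm,
    Complex.norm_real, Real.norm_of_nonneg (by positivity), ← ENNReal.ofReal_pow (by positivity), h]

theorem memHs_iff (s : ℕ) (f : L2 d) : MemHs s f ↔ hsEnergy s (𝓕 f : L2 d) < ∞ := by
  rw [← eLpNorm_besselMul_sq]
  constructor
  · intro h
    exact ENNReal.pow_lt_top h.2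
  · intro h
    refine ⟨?_, by simpa using h⟩
    have : Continuous fun w : Space d => (1 + ‖angular w‖ ^ 2) ^ ((s : ℝ) / 2) :=
      Continuous.rpow_const (by have := continuous_angular (d := d); fun_prop)
        fun w => Or.inl (by positivity)
    exact (Complex.continuous_ofReal.comp this).aestronglyMeasurable.mul
      (Lp.aestronglyMeasurable _)

theorem memHs_conv_mul (s : ℕ) (κ : SchwartzMap (Space d) ℂ) {f : Space d → ℂ}
    (hf : Integrable f) {g : L2 d} (hg : MemHs s g) :
    MemHs s (mulL (conv κ f) (memLp_conv κ hf) g) := by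
  rw [memHs_iff] at hg ⊢
  exact (hsEnergy_fourier_conv_le s κ hf g hg).trans_lt (ENNReal.mul_lt_top ENNReal.ofReal_lt_top hg)

theorem hsNorm_conv_mul_le (s : ℕ) (κ : SchwartzMap (Space d) ℂ) {f : Space d → ℂ}
    (hf : Integrable f) {g : L2 d} (hg : MemHs s g) :
    hsNorm s (mulL (conv κ f) (memLp_conv κ hf) g)
      ≤ (2 + 2 * d) ^ s * supNorm s κ * (∫ y, ‖f y‖) * hsNorm s g := by
  have h := hsEnergy_fourier_conv_le s κ hf g ((memHs_iff s g).1 hg)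
  have hf0 : 0 ≤ ∫ y, ‖f y‖ := integral_nonneg fun _ => norm_nonneg _
  have hs0 := supNorm_nonneg s κ
  have h1 := ENNReal.toReal_mono
    (ENNReal.mul_lt_top ENNReal.ofReal_lt_top ((memHs_iff s g).1 hg)).ne h
  rw [← eLpNorm_besselMul_sq, ← eLpNorm_besselMul_sq, ENNReal.toReal_mul, ENNReal.toReal_pow,
    ENNReal.toReal_pow, ENNReal.toReal_ofReal (by positivity)] at h1
  refine le_of_sq_le_sq ?_ (by unfold hsNorm; positivity)
  refine h1.trans ?_
  -- The sharp constant here would be the square root of (2 + 2d)^s; since this number is at least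
  -- 1, it replaces its own root.
  have h2 : (1 : ℝ) ≤ (2 + 2 * d) ^ s := one_le_pow₀ (by linarith [d.cast_nonneg (α := ℝ)])
  calc _ ≤ ((2 + 2 * d : ℝ) ^ s * (2 + 2 * d) ^ s) * (supNorm s κ * ∫ y, ‖f y‖) ^ 2
        * (eLpNorm (besselMul s g) 2 volume).toReal ^ 2 := by
        gcongr
        exact le_mul_of_one_le_left (by positivity) h2
    _ = _ := by unfold hsNorm; ring

/-- Multiplication by `κ * f` on `H^s`, transported to `L²` by the Bessel potential. -/
def convMul (s : ℕ) (κ : SchwartzMap (Space d) ℂ) {f : Space d → ℂ} (hf : Integrable f) :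
    L2 d →L[ℂ] L2 d :=
  LinearMap.mkContinuous
    { toFun := fun g => besselInv s _ (memHs_conv_mul s κ hf (memHs_bessel s g))
      map_add' := fun g h => bessel_injective s (by simp only [map_add, bessel_besselInv])
      map_smul' := fun c g => bessel_injective s (by
        simp only [map_smul, bessel_besselInv, RingHom.id_apply]) }
    ((2 + 2 * d) ^ s * supNorm s κ * ∫ y, ‖f y‖)
    (fun g => by
      change ‖besselInv s _ (memHs_conv_mul s κ hf (memHs_bessel s g))‖ ≤ _
      rw [← hsNorm_bessel s, bessel_besselInv]
      refine (hsNorm_conv_mul_le s κ hf (memHs_bessel s g)).trans_eq ?_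
      rw [hsNorm_bessel])

theorem bessel_convMul (s : ℕ) (κ : SchwartzMap (Space d) ℂ) {f : Space d → ℂ} (hf : Integrable f)
    (g : L2 d) :
    bessel s (convMul s κ hf g) = mulL (conv κ f) (memLp_conv κ hf) (bessel s g) :=
  bessel_besselInv s _ _

theorem norm_convMul_le (s : ℕ) (κ : SchwartzMap (Space d) ℂ) {f : Space d → ℂ}
    (hf : Integrable f) : ‖convMul s κ hf‖ ≤ (2 + 2 * d) ^ s * supNorm s κ * ∫ y, ‖f y‖ :=
  LinearMap.mkContinuous_norm_le _ (by
    have := supNorm_nonneg s κ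
    have : 0 ≤ ∫ y, ‖f y‖ := integral_nonneg fun _ => norm_nonneg _
    positivity) _

theorem convMul_zero (κ : SchwartzMap (Space d) ℂ) {f : Space d → ℂ} (hf : Integrable f) :
    convMul 0 κ hf = mulL (conv κ f) (memLp_conv κ hf) := by
  ext1 g
  rw [← bessel_zero (convMul 0 κ hf g), bessel_convMul, bessel_zero]

theorem conv_sub (κ : SchwartzMap (Space d) ℂ) {f g : Space d → ℂ} (hf : Integrable f)
    (hg : Integrable g) (x : Space d) : conv κ (f - g) x = conv κ f x - conv κ g x := by
  unfold conv
  rw [← integral_sub (integrable_conv κ hf x) (integrable_conv κ hg x)]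
  simp only [Pi.sub_apply, mul_sub]

/-- Linearity in f reduces the Lipschitz dependence of the potential on u to the operator bound for
|u|² - |v|². -/
theorem convMul_sub (s : ℕ) (κ : SchwartzMap (Space d) ℂ) {f g : Space d → ℂ}
    (hf : Integrable f) (hg : Integrable g) :
    convMul s κ hf - convMul s κ hg = convMul s κ (hf.sub hg) := by
  ext1 h
  refine bessel_injective s ?_
  rw [sub_apply, map_sub, bessel_convMul, bessel_convMul, bessel_convMul]
  symm
  refine mulL_eq_of_ae ?_
  filter_upwards [Lp.coeFn_sub (mulL (conv κ f) (memLp_conv κ hf) (bessel s h))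
    (mulL (conv κ g) (memLp_conv κ hg) (bessel s h)),
    coeFn_mulL _ (memLp_conv κ hf) (bessel s h), coeFn_mulL _ (memLp_conv κ hg) (bessel s h)]
    with x h1 h2 h3
  rw [h1, Pi.sub_apply, h2, h3, conv_sub κ hf hg, sub_mul]

end Sobolev

/-! ### The density `|u|²` and the saturated nonlinearity -/

section Density

variable {d : ℕ}

/-- The density `|u|²`. -/
def density (u : L2 d) (y : Space d) : ℂ := ((‖u y‖ ^ 2 : ℝ) : ℂ)

theorem integrable_norm_mul_norm (u v : L2 d) : Integrable fun y => ‖u y‖ * ‖v y‖ :=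
  (Lp.memLp u).norm.integrable_mul (Lp.memLp v).norm

theorem integral_norm_mul_norm_le (u v : L2 d) : ∫ y, ‖u y‖ * ‖v y‖ ≤ ‖u‖ * ‖v‖ := by
  have hn : ∀ u : L2 d, ‖(Lp.memLp u).norm.toLp‖ = ‖u‖ := fun u => by
    rw [Lp.norm_toLp, eLpNorm_norm, Lp.norm_def]
  have h := real_inner_le_norm (Lp.memLp u).norm.toLp (Lp.memLp v).norm.toLp
  rw [hn, hn, L2.inner_def] at h
  refine le_trans (le_of_eq ?_) h
  refine integral_congr_ae ?_
  filter_upwards [(Lp.memLp u).norm.coeFn_toLp, (Lp.memLp v).norm.coeFn_toLp] with y h1 h2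
  rw [h1, h2, real_inner_eq_re_inner, RCLike.inner_apply]
  simp [mul_comm]

theorem integrable_density (u : L2 d) : Integrable (density u) := by
  have := (integrable_norm_mul_norm u u).ofReal (𝕜 := ℂ)
  refine this.congr (Eventually.of_forall fun y => ?_)
  simp [density, sq]

/-- Factor ||u|² - |v|²| ≤ (|u| + |v|)|u - v|, then apply the Cauchy–Schwarz inequality. -/
theorem integral_norm_density_sub_le (u v : L2 d) :
    ∫ y, ‖(density u - density v) y‖ ≤ (‖u‖ + ‖v‖) * ‖u - v‖ := by
  have h1 : ∀ᵐ y, ‖(density u - density v) y‖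
      ≤ ‖u y‖ * ‖(u - v : L2 d) y‖ + ‖v y‖ * ‖(u - v : L2 d) y‖ := by
    filter_upwards [Lp.coeFn_sub u v] with y hy
    rw [Pi.sub_apply, density, density, ← Complex.ofReal_sub, Complex.norm_real, Real.norm_eq_abs,
      sq_sub_sq, abs_mul, abs_of_nonneg (by positivity), hy, Pi.sub_apply, ← add_mul]
    gcongr
    exact abs_norm_sub_norm_le _ _
  have h2 := integrable_norm_mul_norm u (u - v)
  have h3 := integrable_norm_mul_norm v (u - v)
  refine (integral_mono_ae ((integrable_density u).sub (integrable_density v)).norm (h2.add h3)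
    h1).trans ?_
  have h4 : ∫ y, ((fun y => ‖u y‖ * ‖(u - v : L2 d) y‖) + fun y => ‖v y‖ * ‖(u - v : L2 d) y‖) y
      = _ := integral_add h2 h3
  rw [h4, add_mul]
  exact add_le_add (integral_norm_mul_norm_le _ _) (integral_norm_mul_norm_le _ _)

theorem integral_norm_density_le (u : L2 d) : ∫ y, ‖density u y‖ ≤ ‖u‖ ^ 2 := by
  rw [sq]
  refine le_trans (le_of_eq ?_) (integral_norm_mul_norm_le u u)
  refine integral_congr_ae (Eventually.of_forall fun y => ?_)
  simp [density, sq]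

theorem norm_clm_pow_le {E : Type*} [NormedAddCommGroup E] [NormedSpace ℂ E] {a : E →L[ℂ] E}
    {r : ℝ} (ha : ‖a‖ ≤ r) (n : ℕ) : ‖a ^ n‖ ≤ r ^ n := by
  induction n with
  | zero =>
    rw [pow_zero, pow_zero]
    exact ContinuousLinearMap.norm_id_le
  | succ n ih =>
    rw [pow_succ, pow_succ]
    have hr : 0 ≤ r := (norm_nonneg _).trans ha
    exact (norm_mul_le _ _).trans (by gcongr)

theorem norm_clm_pow_sub_pow_le {E : Type*} [NormedAddCommGroup E] [NormedSpace ℂ E]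
    {a b : E →L[ℂ] E} {r : ℝ} (ha : ‖a‖ ≤ r) (hb : ‖b‖ ≤ r) (n : ℕ) :
    ‖a ^ n - b ^ n‖ ≤ n * r ^ (n - 1) * ‖a - b‖ := by
  have hr : 0 ≤ r := (norm_nonneg _).trans ha
  induction n with
  | zero => simp
  | succ n ih =>
    have e : a ^ (n + 1) - b ^ (n + 1) = a ^ n * (a - b) + (a ^ n - b ^ n) * b := by
      rw [pow_succ, pow_succ]; noncomm_ring
    -- For n = 0 the truncated exponent n - 1 is 0, but the factor n vanishes.
    have h1 : (n : ℝ) * r ^ (n - 1) * r = n * r ^ n := by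
      cases n with
      | zero => simp
      | succ n => rw [Nat.add_sub_cancel, pow_succ]; ring
    rw [e]
    calc _ ≤ ‖a ^ n‖ * ‖a - b‖ + ‖a ^ n - b ^ n‖ * ‖b‖ :=
          (norm_add_le _ _).trans (add_le_add (norm_mul_le _ _) (norm_mul_le _ _))
      _ ≤ r ^ n * ‖a - b‖ + (n * r ^ (n - 1) * ‖a - b‖) * r := by
          gcongr
          exact norm_clm_pow_le ha n
      _ = r ^ n * ‖a - b‖ + (n * r ^ (n - 1) * r) * ‖a - b‖ := by ring
      _ = _ := by rw [h1, Nat.add_sub_cancel]; push_cast; ring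

/-- The operator of multiplication by `c (κ * |u|²)^σ` on `H^s`, transported to `L²`. -/
def saturatedMul (s σ : ℕ) (κ : SchwartzMap (Space d) ℂ) (c : ℂ) (u : L2 d) : L2 d →L[ℂ] L2 d :=
  c • convMul s κ (integrable_density u) ^ σ

/-- The bound of the nonlinearity on the ball of radius `R`, when `D` bounds the kernel. -/
def saturatedBound (σ : ℕ) (D R : ℝ) : ℝ := (D * R ^ 2) ^ σ

/-- The Lipschitz constant of the nonlinearity on the ball of radius `R`, when `D` bounds the
kernel. -/
def saturatedLip (σ : ℕ) (D R : ℝ) : ℝ := σ * (D * R ^ 2) ^ (σ - 1) * (D * (2 * R))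

/-- For every s the ball of radius R is taken in L², not in H^s. The factors R² and 2R come from the
L¹ bounds on |u|² and on |u|² - |v|². -/
theorem isLocallyLipschitz_saturatedMul (s σ : ℕ) {κ : SchwartzMap (Space d) ℂ} {c : ℂ}
    (hc : ‖c‖ ≤ 1) {W : ℝ} (hW : supNorm s κ ≤ W) :
    IsLocallyLipschitz (saturatedMul s σ κ c) (saturatedBound σ ((2 + 2 * d) ^ s * W))
      (saturatedLip σ ((2 + 2 * d) ^ s * W)) := by
  have hκ := supNorm_nonneg s κ
  have hW0 : 0 ≤ W := hκ.trans hW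
  set D : ℝ := (2 + 2 * d) ^ s * W with hD
  have hD0 : 0 ≤ D := by positivity
  have hb : ∀ (R : ℝ) (u : L2 d), ‖u‖ ≤ R → ‖convMul s κ (integrable_density u)‖ ≤ D * R ^ 2 := by
    intro R u hu
    refine (norm_convMul_le s κ _).trans ?_
    have := integral_norm_density_le u
    rw [hD]
    gcongr
    exact this.trans (by gcongr)
  have hl : ∀ (R : ℝ) (u v : L2 d), ‖u‖ ≤ R → ‖v‖ ≤ R →
      ‖convMul s κ (integrable_density u) - convMul s κ (integrable_density v)‖
        ≤ D * (2 * R) * ‖u - v‖ := by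
    intro R u v hu hv
    rw [convMul_sub]
    refine (norm_convMul_le s κ _).trans ?_
    have := integral_norm_density_sub_le u v
    rw [hD, mul_assoc _ (2 * R)]
    gcongr
    refine this.trans ?_
    gcongr
    linarith
  refine ⟨fun R u hu => ?_, fun R u v hu hv => ?_, fun R hR => ?_⟩
  · rw [saturatedMul, norm_smul]
    calc _ ≤ 1 * (D * R ^ 2) ^ σ := by
          gcongr
          exact norm_clm_pow_le (hb R u hu) σ
      _ = _ := by rw [one_mul, saturatedBound]
  · have hR : 0 ≤ R := (norm_nonneg _).trans hu
    rw [saturatedMul, saturatedMul, ← smul_sub, norm_smul]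
    calc _ ≤ 1 * (σ * (D * R ^ 2) ^ (σ - 1) * (D * (2 * R) * ‖u - v‖)) := by
          gcongr
          refine (norm_clm_pow_sub_pow_le (hb R u hu) (hb R v hv) σ).trans ?_
          gcongr
          exact hl R u v hu hv
      _ = _ := by rw [one_mul, saturatedLip]; ring
  · unfold saturatedLip; positivity

theorem bessel_saturatedMul (s σ : ℕ) (κ : SchwartzMap (Space d) ℂ) (c : ℂ) (u g : L2 d) :
    bessel s (saturatedMul s σ κ c u g) = saturatedMul 0 σ κ c u (bessel s g) := by
  have h : ∀ (n : ℕ) (g : L2 d), bessel s ((convMul s κ (integrable_density u) ^ n) g)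
      = (convMul 0 κ (integrable_density u) ^ n) (bessel s g) := by
    intro n
    induction n with
    | zero => intro g; rfl
    | succ n ih =>
      intro g
      rw [pow_succ, pow_succ, mul_apply_eq_comp, mul_apply_eq_comp, ih,
        bessel_convMul, convMul_zero]
  rw [saturatedMul, saturatedMul, smul_apply, smul_apply,
    map_smul, h]

end Density


/-! ### The cut-off as a convolution with the kernel -/

section Kernel

variable {d : ℕ}

/-- The exchange formula ∫ f̂ g = ∫ f ĝ, with g(w) = exp(2πi w·x) m(w), whose Fourier transform at y
is the inverse transform of m at x - y. -/
theorem fourierInv_mul_fourier (m f : Space d → ℂ) (hm : Integrable m) (hf : Integrable f)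
    (x : Space d) : 𝓕⁻ (fun w => m w * 𝓕 f w) x = ∫ y, 𝓕⁻ m (x - y) * f y := by
  set g : Space d → ℂ := fun w => Real.fourierChar ⟪w, x⟫_ℝ • m w with hg
  have hgi : Integrable g := by
    have h := (Real.fourierIntegral_convergent_iff (μ := volume) (f := m) (-x)).2 hm
    simpa [hg] using h
  have h := VectorFourier.integral_fourierIntegral_smul_eq_flip (L := innerₗ (Space d))
    (μ := volume) (ν := volume) Real.continuous_fourierChar continuous_inner hf hgi
  have h1 : 𝓕⁻ (fun w => m w * 𝓕 f w) x
      = ∫ w, VectorFourier.fourierIntegral Real.fourierChar volume (innerₗ (Space d)) f w • g w := by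
    rw [Real.fourierInv_eq]
    refine integral_congr_ae (Eventually.of_forall fun w => ?_)
    simp only [hg, Circle.smul_def, smul_eq_mul]
    change _ * (_ * VectorFourier.fourierIntegral _ _ _ _ _) = _
    ring
  rw [h1, h]
  refine integral_congr_ae (Eventually.of_forall fun y => ?_)
  simp only [smul_eq_mul]
  rw [mul_comm]
  congr 1
  rw [Real.fourierInv_eq]
  refine integral_congr_ae (Eventually.of_forall fun w => ?_)
  simp only [hg, Circle.smul_def, smul_eq_mul, LinearMap.flip_apply, innerₗ_apply_apply]
  rw [← mul_assoc, ← Circle.coe_mul, ← AddChar.map_add_eq_mul, inner_sub_right, real_inner_comm w y]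
  congr 3; ring

/-- Multiplication by `2π` as a continuous linear equivalence. -/
def angularEquiv : Space d ≃L[ℝ] Space d :=
  ContinuousLinearEquiv.smulLeft (Units.mk0 (2 * Real.pi) Real.two_pi_pos.ne')

/-- The symbol of the cut-off in Mathlib's frequency variable, with complex values. -/
def cutoffSymbol (χ : SchwartzMap (Space d) ℝ) : SchwartzMap (Space d) ℂ :=
  (χ.compCLMOfContinuousLinearEquiv ℝ angularEquiv).postcompCLM Complex.ofRealCLM

/-- The kernel of the cut-off as a Schwartz function. -/
def schwartzKernel (χ : SchwartzMap (Space d) ℝ) : SchwartzMap (Space d) ℂ := 𝓕⁻ (cutoffSymbol χ)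

theorem coe_schwartzKernel (χ : SchwartzMap (Space d) ℝ) : ⇑(schwartzKernel χ) = kernel χ :=
  SchwartzMap.fourierInv_coe _

theorem cutoff_eq_conv (χ : SchwartzMap (Space d) ℝ) {f : Space d → ℂ} (hf : Integrable f) :
    cutoff χ f = conv (schwartzKernel χ) f := by
  ext x
  unfold conv
  rw [coe_schwartzKernel]
  exact fourierInv_mul_fourier (cutoffSymbol χ) f (cutoffSymbol χ).integrable hf x

/-- Conjugation reverses the sign of the phase, and w ↦ -w restores it since χ is real and even. -/
theorem conj_kernel {χ : SchwartzMap (Space d) ℝ} (hχ : ∀ ξ, χ (-ξ) = χ ξ) (x : Space d) :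
    (starRingEnd ℂ) (kernel χ x) = kernel χ x := by
  unfold kernel
  rw [Real.fourierInv_eq, ← integral_conj, ← integral_neg_eq_self]
  refine integral_congr_ae (Eventually.of_forall fun w => ?_)
  have : χ (angular (-w)) = χ (angular w) := by
    rw [show angular (-w) = -angular w by simp [angular], hχ]
  simp only [this, Circle.smul_def, smul_eq_mul, map_mul, Complex.conj_ofReal, inner_neg_left]
  congr 1
  rw [← Circle.coe_inv_eq_conj, AddChar.map_neg_eq_inv, inv_inv]

theorem conj_conv_density {χ : SchwartzMap (Space d) ℝ} (hχ : ∀ ξ, χ (-ξ) = χ ξ) (u : L2 d)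
    (x : Space d) : (starRingEnd ℂ) (conv (schwartzKernel χ) (density u) x)
      = conv (schwartzKernel χ) (density u) x := by
  unfold conv
  rw [← integral_conj]
  refine integral_congr_ae (Eventually.of_forall fun y => ?_)
  simp only [map_mul, coe_schwartzKernel, conj_kernel hχ, density, Complex.conj_ofReal]

theorem potential_eq_conv (χ : SchwartzMap (Space d) ℝ) (u : L2 d) :
    potential χ u = conv (schwartzKernel χ) (density u) :=
  cutoff_eq_conv χ (integrable_density u)

/-- The inequality holds on a closed set of full measure, hence on a dense closed set, hence
everywhere. The bound C keeps the essential supremum finite, so `toReal` does not collapse to 0. -/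
theorem norm_le_eLpNorm_top {F : Type*} [NormedAddCommGroup F] {f : Space d → F}
    (hf : Continuous f) {C : ℝ} (hC : ∀ x, ‖f x‖ ≤ C) (x : Space d) :
    ‖f x‖ ≤ (eLpNorm f ∞ volume).toReal := by
  have hfin : eLpNorm f ∞ volume < ∞ :=
    (memLp_top_of_bound hf.aestronglyMeasurable C (Eventually.of_forall hC)).2
  have hae : ∀ᵐ x, ‖f x‖ ≤ (eLpNorm f ∞ volume).toReal := by
    filter_upwards [ae_le_eLpNormEssSup (f := f) (μ := volume)] with x hx
    rw [← eLpNorm_exponent_top] at hx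
    rw [← toReal_enorm]
    exact ENNReal.toReal_mono hfin.ne hx
  have hclosed : IsClosed {x | ‖f x‖ ≤ (eLpNorm f ∞ volume).toReal} :=
    isClosed_le hf.norm continuous_const
  have hdense : Dense {x | ‖f x‖ ≤ (eLpNorm f ∞ volume).toReal} :=
    Measure.dense_of_ae hae
  have : {x | ‖f x‖ ≤ (eLpNorm f ∞ volume).toReal} = univ :=
    hclosed.closure_eq ▸ hdense.closure_eq
  exact (this.symm ▸ mem_univ x : x ∈ {x | ‖f x‖ ≤ (eLpNorm f ∞ volume).toReal})

theorem seminorm_le_eLpNorm (κ : SchwartzMap (Space d) ℂ) (k : ℕ) :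
    SchwartzMap.seminorm ℝ 0 k κ
      ≤ (eLpNorm (fun x => iteratedFDeriv ℝ k κ x) ∞ volume).toReal := by
  refine SchwartzMap.seminorm_le_bound ℝ 0 k _ ENNReal.toReal_nonneg fun x => ?_
  rw [pow_zero, one_mul]
  exact norm_le_eLpNorm_top (f := fun x => iteratedFDeriv ℝ k κ x)
    ((κ.smooth k).continuous_iteratedFDeriv le_rfl)
    (fun x => SchwartzMap.norm_iteratedFDeriv_le_seminorm ℝ κ k x) x

theorem supNorm_le_wInfNorm (s : ℕ) (χ : SchwartzMap (Space d) ℝ) :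
    supNorm s (schwartzKernel χ) ≤ wInfNorm s (kernel χ) := by
  unfold supNorm wInfNorm
  rw [← coe_schwartzKernel]
  exact Finset.sum_le_sum fun k _ => seminorm_le_eLpNorm _ k

theorem supNorm_zero_le_eLpNorm (χ : SchwartzMap (Space d) ℝ) :
    supNorm 0 (schwartzKernel χ) ≤ (eLpNorm (kernel χ) ∞ volume).toReal := by
  rw [supNorm, Finset.sum_range_one, ← coe_schwartzKernel]
  refine SchwartzMap.seminorm_le_bound ℝ 0 0 _ ENNReal.toReal_nonneg fun x => ?_
  rw [pow_zero, one_mul, norm_iteratedFDeriv_zero]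
  exact norm_le_eLpNorm_top (schwartzKernel χ).continuous (norm_le_supNorm 0 _) x

theorem supNorm_zero_le (s : ℕ) (κ : SchwartzMap (Space d) ℂ) : supNorm 0 κ ≤ supNorm s κ :=
  Finset.sum_le_sum_of_subset_of_nonneg (by simp) fun _ _ _ => apply_nonneg _ _

theorem inner_mulL_left {m : Space d → ℂ} (hm : MemLp m ∞ volume)
    (hreal : ∀ x, (starRingEnd ℂ) (m x) = m x) (f g : L2 d) :
    inner ℂ (mulL m hm f) g = inner ℂ f (mulL m hm g) := by
  rw [L2.inner_def, L2.inner_def]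
  refine integral_congr_ae ?_
  filter_upwards [coeFn_mulL m hm f, coeFn_mulL m hm g] with x h1 h2
  simp only [RCLike.inner_apply, h1, h2, map_mul, hreal]
  ring

/-- Multiplication by the real potential is symmetric, and so are its powers; ⟨f, T^σ f⟩ is real,
and the factor -iε makes it purely imaginary. -/
theorem re_inner_saturatedMul (σ : ℕ) {χ : SchwartzMap (Space d) ℝ} (hχ : ∀ ξ, χ (-ξ) = χ ξ)
    (ε : ℝ) (u f : L2 d) :
    (inner ℂ f (saturatedMul 0 σ (schwartzKernel χ) (-(Complex.I * ε)) u f)).re = 0 := by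
  set T := convMul 0 (schwartzKernel χ) (integrable_density u) with hT
  have hsym : (T : L2 d →ₗ[ℂ] L2 d).IsSymmetric := fun f g => by
    rw [hT, convMul_zero]
    exact inner_mulL_left _ (conj_conv_density hχ u) f g
  have h := (hsym.pow σ) f f
  rw [← ContinuousLinearMap.toLinearMap_pow] at h
  change inner ℂ ((T ^ σ) f) f = inner ℂ f ((T ^ σ) f) at h
  have him : (inner ℂ f ((T ^ σ) f)).im = 0 := by
    rw [← inner_conj_symm] at h
    exact Complex.conj_eq_iff_im.1 h
  change (inner ℂ f ((-(Complex.I * ε)) • ((T ^ σ) f))).re = 0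
  rw [inner_smul_right, Complex.mul_re, him]
  simp

theorem nonlinearity_eq (χ : SchwartzMap (Space d) ℝ) (σ : ℕ) (u : L2 d) :
    nonlinearity χ σ u
      = (convMul 0 (schwartzKernel χ) (integrable_density u) ^ σ) u := by
  have h : ∀ n : ℕ, (convMul 0 (schwartzKernel χ) (integrable_density u) ^ n) u
      =ᵐ[volume] fun x => potential χ u x ^ n * u x := by
    intro n
    induction n with
    | zero => exact Eventually.of_forall fun x => by simp
    | succ n ih =>
      rw [pow_succ', mul_apply_eq_comp, convMul_zero]
      filter_upwards [coeFn_mulL _ (memLp_conv (schwartzKernel χ) (integrable_density u))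
        ((convMul 0 (schwartzKernel χ) (integrable_density u) ^ n) u), ih] with x h1 h2
      rw [convMul_zero] at h1 h2
      rw [h1, h2, potential_eq_conv, pow_succ']
      ring
  exact Lp.ext ((MemLp.coeFn_toLp _).trans (h σ).symm)

end Kernel


/-! ### The unitary group of `P(D)`, and the equation in the interaction picture -/

section Equation

variable {d : ℕ} {P : Space d → ℝ}

theorem aemeasurable_comp_angular (hP : AEMeasurable P volume) :
    AEMeasurable (fun w => P (angular w)) volume := by
  refine hP.comp_quasiMeasurePreserving ⟨continuous_angular.measurable, ?_⟩
  have h := Measure.map_addHaar_smul (volume : Measure (Space d)) Real.two_pi_pos.ne'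
  change Measure.map (fun w : Space d => (2 * Real.pi) • w) volume ≪ volume
  rw [h]
  exact Measure.smul_absolutelyContinuous

theorem IsIsometricGroup.fourierConj {V : ℝ → L2 d →L[ℂ] L2 d} (hV : IsIsometricGroup V) :
    IsIsometricGroup fun t => fourierConj (V t) where
  zero f := by rw [fourierConj_apply, hV.zero, fourierInv_fourier_eq]
  add s t f := by
    rw [fourierConj_apply, fourierConj_apply, fourier_fourierConj, hV.add]
  norm t f := by
    rw [← Lp.norm_fourier_eq, fourier_fourierConj, hV.norm, Lp.norm_fourier_eq]
  cont f := (fourierCLE ℂ (L2 d)).symm.continuous.comp (hV.cont (𝓕 f))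

/-- The unitary group `exp(i t P(D))`. -/
def schrodingerGroup (hP : AEMeasurable P volume) (t : ℝ) : L2 d →L[ℂ] L2 d :=
  fourierConj (expMul _ (aemeasurable_comp_angular hP) t)

theorem isIsometricGroup_schrodingerGroup (hP : AEMeasurable P volume) :
    IsIsometricGroup (schrodingerGroup hP) :=
  (isIsometricGroup_expMul (aemeasurable_comp_angular hP)).fourierConj

theorem bessel_schrodingerGroup (hP : AEMeasurable P volume) (s : ℕ) (t : ℝ) (g : L2 d) :
    bessel s (schrodingerGroup hP t g) = schrodingerGroup hP t (bessel s g) := by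
  simp only [bessel, schrodingerGroup, fourierConj_apply, fourier_fourierInv_eq]
  congr 1
  have hp := aemeasurable_comp_angular hP
  refine mulL_eq_of_ae ?_
  filter_upwards [coeFn_expMul hp t (𝓕 g : L2 d), coeFn_mulL _ (memLp_besselSymbol s) (𝓕 g : L2 d),
    coeFn_expMul hp t (mulL _ (memLp_besselSymbol s) (𝓕 g : L2 d))] with w h1 h2 h3
  rw [h3, h2, h1]
  ring

theorem fourier_multiplierOp {φ : L2 d} (hφ : InDomain P φ) :
    (𝓕 (multiplierOp P φ hφ) : L2 d) = MemLp.toLp (symbolMul P φ) hφ := by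
  rw [multiplierOp, fourier_fourierInv_eq]

theorem hasDerivAt_schrodingerGroup (hP : AEMeasurable P volume) {φ : L2 d} (hφ : InDomain P φ)
    (t : ℝ) : HasDerivAt (fun t => schrodingerGroup hP t φ)
      (schrodingerGroup hP t (Complex.I • multiplierOp P φ hφ)) t := by
  have hg : (𝓕 (Complex.I • multiplierOp P φ hφ) : L2 d) =ᵐ[volume]
      fun w => Complex.I * (P (angular w) : ℝ) * (𝓕 φ : L2 d) w := by
    rw [FourierTransform.fourier_smul, fourier_multiplierOp]
    filter_upwards [Lp.coeFn_smul Complex.I (MemLp.toLp (symbolMul P φ) hφ), hφ.coeFn_toLp]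
      with w h1 h2
    rw [h1, Pi.smul_apply, h2, symbolMul, smul_eq_mul, mul_assoc]
  exact (((fourierCLE ℂ (L2 d)).symm.toContinuousLinearMap.restrictScalars
    ℝ).hasFDerivAt).comp_hasDerivAt t (hasDerivAt_expMul (aemeasurable_comp_angular hP) hg t)

theorem symbolMul_schrodingerGroup (hP : AEMeasurable P volume) {φ : L2 d} (hφ : InDomain P φ)
    (t : ℝ) : symbolMul P (schrodingerGroup hP t φ) =ᵐ[volume]
      expMul _ (aemeasurable_comp_angular hP) t (MemLp.toLp (symbolMul P φ) hφ) := by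
  unfold symbolMul
  rw [schrodingerGroup, fourier_fourierConj]
  have hp := aemeasurable_comp_angular hP
  filter_upwards [coeFn_expMul hp t (𝓕 φ : L2 d),
    coeFn_expMul hp t (MemLp.toLp (symbolMul P φ) hφ), hφ.coeFn_toLp] with w h1 h2 h3
  rw [h1]
  refine Eq.trans ?_ h2.symm
  rw [h3, symbolMul]
  ring

theorem inDomain_schrodingerGroup (hP : AEMeasurable P volume) {φ : L2 d} (hφ : InDomain P φ)
    (t : ℝ) : InDomain P (schrodingerGroup hP t φ) :=
  (memLp_congr_ae (symbolMul_schrodingerGroup hP hφ t)).2 (Lp.memLp _)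

theorem multiplierOp_schrodingerGroup (hP : AEMeasurable P volume) {φ : L2 d} (hφ : InDomain P φ)
    (t : ℝ) : multiplierOp P _ (inDomain_schrodingerGroup hP hφ t)
      = schrodingerGroup hP t (multiplierOp P φ hφ) := by
  have h : schrodingerGroup hP t (multiplierOp P φ hφ)
    = 𝓕⁻ (expMul _ (aemeasurable_comp_angular hP) t (𝓕 (multiplierOp P φ hφ)) : L2 d) := rfl
  rw [h, fourier_multiplierOp, multiplierOp]
  congr 1
  exact Lp.ext ((MemLp.coeFn_toLp _).trans (symbolMul_schrodingerGroup hP hφ t))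

/-- The domain of `P(D)` separates points. -/
theorem eq_zero_of_inner_domain_eq_zero (hP : AEMeasurable P volume) {f : L2 d}
    (h : ∀ φ : L2 d, InDomain P φ → inner ℂ φ f = 0) : f = 0 := by
  set m : Space d → ℂ := fun w => (((1 + |P (angular w)|)⁻¹ : ℝ) : ℂ) with hm
  have hp := aemeasurable_comp_angular hP
  have hm0 : ∀ w, 0 < (1 + |P (angular w)|)⁻¹ := fun w => by positivity
  have hm1 : ∀ w, (1 + |P (angular w)|)⁻¹ ≤ 1 := fun w =>
    inv_le_one_of_one_le₀ (by linarith [abs_nonneg (P (angular w))])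
  have hmm : MemLp m ∞ volume := by
    refine memLp_top_of_bound ?_ 1 (Eventually.of_forall fun w => ?_)
    · exact (Complex.measurable_ofReal.comp_aemeasurable
        ((hp.abs.const_add 1).inv)).aestronglyMeasurable
    · rw [hm, Complex.norm_real, Real.norm_of_nonneg (hm0 w).le]; exact hm1 w
  set F : L2 d := 𝓕 f with hF
  -- The test function has Fourier transform m²F. One factor m compensates P, so φ is in the domain;
  -- symmetry of m turns the pairing with f into ‖mF‖², and m > 0.
  set φ : L2 d := 𝓕⁻ (mulL m hmm (mulL m hmm F) : L2 d) with hφ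
  have hFφ : (𝓕 φ : L2 d) = mulL m hmm (mulL m hmm F) := fourier_fourierInv_eq _
  have hdom : InDomain P φ := by
    refine MemLp.of_le_mul (g := (F : Space d → ℂ)) (c := 1) (Lp.memLp F) ?_ ?_
    · exact (Complex.measurable_ofReal.comp_aemeasurable hp).aestronglyMeasurable.mul
        (Lp.aestronglyMeasurable _)
    · unfold symbolMul
      rw [hFφ]
      filter_upwards [coeFn_mulL m hmm (mulL m hmm F), coeFn_mulL m hmm F] with w h1 h2
      rw [h1, h2, norm_mul, norm_mul, norm_mul, hm, Complex.norm_real, Complex.norm_real,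
        Real.norm_of_nonneg (hm0 w).le, Real.norm_eq_abs, ← mul_assoc, ← mul_assoc]
      gcongr
      have h3 : |P (angular w)| * (1 + |P (angular w)|)⁻¹ ≤ 1 := by
        rw [← div_eq_mul_inv, div_le_one (by positivity)]; linarith
      exact mul_le_one₀ h3 (hm0 w).le (hm1 w)
  have h0 := h φ hdom
  rw [← Lp.inner_fourier_eq, hFφ,
    inner_mulL_left hmm (fun w => Complex.conj_ofReal _), ← hF, inner_self_eq_zero] at h0
  have hF0 : F = 0 := by
    refine Lp.ext ?_
    filter_upwards [coeFn_mulL m hmm F, Lp.coeFn_zero ℂ 2 (volume : Measure (Space d))]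
      with w h1 h2
    rw [h0, h2] at h1
    rw [h2]
    refine (mul_eq_zero.1 h1.symm).resolve_left ?_
    exact Complex.ofReal_ne_zero.2 (hm0 w).ne'
  rw [← norm_eq_zero, ← Lp.norm_fourier_eq, ← hF, hF0, norm_zero]

/-- A product rule with u merely continuous: since w vanishes at t, the slope of the pairing is the
pairing of the slope of w with u. Weak solutions are not known to be differentiable in norm. -/
theorem hasDerivAt_inner_of_eq_zero {w : ℝ → L2 d} {w' : L2 d} {t : ℝ} (hw : HasDerivAt w w' t)
    (h0 : w t = 0) {u : ℝ → L2 d} (hu : ContinuousAt u t) :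
    HasDerivAt (fun r => inner ℂ (w r) (u r)) (inner ℂ w' (u t)) t := by
  rw [hasDerivAt_iff_tendsto_slope] at hw ⊢
  have h1 := hw.inner (𝕜 := ℂ) (hu.tendsto.mono_left (nhdsWithin_le_nhds (s := {t}ᶜ)))
  refine h1.congr fun r => ?_
  rw [slope_def_module, slope_def_module, h0, sub_zero, inner_zero_left, sub_zero]
  exact (inner_smul_left_eq_smul (w r) (u r) (r - t)⁻¹)

variable {χ : SchwartzMap (Space d) ℝ} {σ : ℕ} {ε : ℝ}

/-- The operator `-i ε (Π(|u|²))^σ`. -/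
def nlsOp (χ : SchwartzMap (Space d) ℝ) (σ : ℕ) (ε : ℝ) (s : ℕ) (u : L2 d) : L2 d →L[ℂ] L2 d :=
  saturatedMul s σ (schwartzKernel χ) (-(Complex.I * ε)) u

theorem nlsOp_apply_self (u : L2 d) :
    nlsOp χ σ ε 0 u u = (-(Complex.I * ε)) • nonlinearity χ σ u := by
  rw [nonlinearity_eq]; rfl

/-- Moving the group onto the test function, ⟨φ, u⟩ = ⟨U(-τ)φ, v⟩ has two differentiable factors,
because φ lies in the domain of P(D). -/
theorem isSolution_of_interaction (hP : AEMeasurable P volume) {v : ℝ → L2 d}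
    (hv : ∀ t, HasDerivAt v (interactionField (schrodingerGroup hP) (nlsOp χ σ ε 0) t (v t)) t)
    {u : C(ℝ, L2 d)} (hu : ∀ t, u t = schrodingerGroup hP t (v t)) : IsSolution P χ σ ε u := by
  intro φ hφ t
  have hU := isIsometricGroup_schrodingerGroup hP
  have h1 : ∀ τ, inner ℂ φ (u τ) = inner ℂ (schrodingerGroup hP (-τ) φ) (v τ) := fun τ => by
    have := hU.inner_neg (-τ) φ (v τ)
    rwa [neg_neg, ← hu] at this
  have h2 := (hasDerivAt_schrodingerGroup hP hφ (-t)).scomp t (hasDerivAt_neg t)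
  have h3 := h2.inner ℂ (hv t)
  refine ⟨_, h3.congr_of_eventuallyEq (Eventually.of_forall h1), ?_⟩
  have h4 : inner ℂ (schrodingerGroup hP (-t) φ)
      (interactionField (schrodingerGroup hP) (nlsOp χ σ ε 0) t (v t))
      = -(Complex.I * ε) * inner ℂ φ (nonlinearity χ σ (u t)) := by
    rw [interactionField, ← hu, hU.inner_neg, hU.apply_neg, nlsOp_apply_self, inner_smul_right]
  have h5 : inner ℂ ((-1 : ℝ) • schrodingerGroup hP (-t) (Complex.I • multiplierOp P φ hφ)) (v t)
      = Complex.I * inner ℂ (multiplierOp P φ hφ) (u t) := by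
    rw [neg_one_smul, inner_neg_left, ← neg_neg t, ← hU.inner_neg, neg_neg, neg_neg, ← hu,
      inner_smul_left, Complex.conj_I]
    ring
  simp only [Function.comp_apply]
  rw [h4, h5]
  linear_combination (-(ε : ℂ) * inner ℂ φ (nonlinearity χ σ (u t))
    + inner ℂ (multiplierOp P φ hφ) (u t)) * Complex.I_mul_I

/-- Pairing U(-r)u(r) with φ gives ⟨U(r)φ, u(r)⟩. Splitting U(r)φ into the frozen vector U(t)φ and
an increment vanishing at r = t, the equation differentiates the first part and
`hasDerivAt_inner_of_eq_zero` the second; the P(D) terms cancel. The weak derivative F is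
continuous, so U(-t)u(t) minus its initial value and the integral of F pairs to zero with the whole
domain, and hence vanishes. -/
theorem interaction_of_isSolution (hP : AEMeasurable P volume)
    (hc : Continuous (nlsOp χ σ ε 0)) {u : C(ℝ, L2 d)} (hu : IsSolution P χ σ ε u) (t : ℝ) :
    HasDerivAt (fun t => schrodingerGroup hP (-t) (u t))
      (interactionField (schrodingerGroup hP) (nlsOp χ σ ε 0) t (schrodingerGroup hP (-t) (u t)))
      t := by
  have hU := isIsometricGroup_schrodingerGroup hP
  set F : ℝ → L2 d := fun t => schrodingerGroup hP (-t) (nlsOp χ σ ε 0 (u t) (u t)) with hF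
  have hFc : Continuous F := hU.continuous_apply continuous_neg
    ((hc.comp u.continuous).clm_apply u.continuous)
  have hFt : interactionField (schrodingerGroup hP) (nlsOp χ σ ε 0) t
      (schrodingerGroup hP (-t) (u t)) = F t := by
    rw [interactionField, hU.apply_neg]
  rw [hFt]
  -- the weak form of the equation
  have hweak : ∀ φ : L2 d, InDomain P φ → ∀ t, HasDerivAt
      (fun r => inner ℂ φ (schrodingerGroup hP (-r) (u r))) (inner ℂ φ (F t)) t := by
    intro φ hφ t
    obtain ⟨a, ha, hae⟩ := hu _ (inDomain_schrodingerGroup hP hφ t) t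
    have h1 := hasDerivAt_inner_of_eq_zero
      (w := fun r => schrodingerGroup hP r φ - schrodingerGroup hP t φ)
      ((hasDerivAt_schrodingerGroup hP hφ t).sub_const _) (sub_self _) u.continuous.continuousAt
    have h2 := (h1.add ha).congr_of_eventuallyEq (f₁ :=
      fun r => inner ℂ φ (schrodingerGroup hP (-r) (u r))) (Eventually.of_forall fun r => by
        simp only [Pi.add_apply]
        rw [hU.inner_neg, inner_sub_left, sub_add_cancel])
    refine h2.congr_deriv ?_
    rw [hF, hU.inner_neg, nlsOp_apply_self, inner_smul_right, map_smul, inner_smul_left,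
      Complex.conj_I]
    rw [multiplierOp_schrodingerGroup hP hφ] at hae
    linear_combination (-Complex.I) * hae + a * Complex.I_mul_I
  have hint : ∀ t, HasDerivAt (fun t => ∫ s in (0 : ℝ)..t, F s) (F t) t := fun t =>
    intervalIntegral.integral_hasDerivAt_right (hFc.intervalIntegrable _ _)
      (hFc.stronglyMeasurableAtFilter _ _) hFc.continuousAt
  have hv : ∀ t, schrodingerGroup hP (-t) (u t)
      = schrodingerGroup hP (-0) (u 0) + ∫ s in (0 : ℝ)..t, F s := by
    intro t
    rw [← sub_eq_zero]
    refine eq_zero_of_inner_domain_eq_zero hP fun φ hφ => ?_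
    have hd : ∀ t, HasDerivAt (fun t => inner ℂ φ (schrodingerGroup hP (-t) (u t))
        - inner ℂ φ (∫ s in (0 : ℝ)..t, F s)) 0 t := fun t => by
      have h1 := (hasDerivAt_const t φ).inner ℂ (hint t)
      have h2 := (hweak φ hφ t).sub h1
      refine h2.congr_deriv ?_
      simp
    have h3 := is_const_of_deriv_eq_zero (fun t => (hd t).differentiableAt)
      (fun t => (hd t).deriv) t 0
    simp only [intervalIntegral.integral_same, inner_zero_right, sub_zero] at h3
    rw [inner_sub_right, inner_add_right, ← h3]
    ring
  exact ((hint t).const_add (schrodingerGroup hP (-0) (u 0))).congr_of_eventuallyEq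
    (Eventually.of_forall hv)

end Equation


/-! ### The flow and its properties -/

section Flow

variable {d : ℕ} {P : Space d → ℝ} {χ : SchwartzMap (Space d) ℝ} {σ : ℕ} {ε : ℝ}

/-- The Lipschitz rate in `L²` on the ball of radius `R`, when `W` bounds the kernel. -/
def rateL2 (σ : ℕ) (W R : ℝ) : ℝ := saturatedBound σ W R + saturatedLip σ W R * R

/-- The Lipschitz rate in `H^s` on the ball of radius `R`, when `W` bounds the kernel and its
derivatives up to order `s`. -/
def rateHs (d σ s : ℕ) (W R : ℝ) : ℝ :=
  2 * saturatedBound σ ((2 + 2 * d) ^ s * W) R + rateL2 σ W R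
    + saturatedLip σ ((2 + 2 * d) ^ s * W) R * R

theorem isLocallyLipschitz_nlsOp (hε : ε = 1 ∨ ε = -1) (s : ℕ) {W : ℝ}
    (hW : supNorm s (schwartzKernel χ) ≤ W) :
    IsLocallyLipschitz (nlsOp χ σ ε s) (saturatedBound σ ((2 + 2 * d) ^ s * W))
      (saturatedLip σ ((2 + 2 * d) ^ s * W)) :=
  isLocallyLipschitz_saturatedMul s σ (by rcases hε with rfl | rfl <;> simp) hW

theorem isLocallyLipschitz_nlsOp_zero (hε : ε = 1 ∨ ε = -1) {W : ℝ}
    (hW : supNorm 0 (schwartzKernel χ) ≤ W) :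
    IsLocallyLipschitz (nlsOp χ σ ε 0) (saturatedBound σ W) (saturatedLip σ W) := by
  have h := isLocallyLipschitz_nlsOp (σ := σ) hε 0 hW
  rwa [pow_zero, one_mul] at h

/-- The solution `v = exp(-i t P(D)) u` of the equation in the interaction picture. -/
structure IsInteractionSolution (hP : AEMeasurable P volume) (χ : SchwartzMap (Space d) ℝ) (σ : ℕ)
    (ε : ℝ) (u₀ : L2 d) (v : ℝ → L2 d) : Prop where
  init : v 0 = u₀
  deriv : ∀ t, HasDerivAt v (interactionField (schrodingerGroup hP) (nlsOp χ σ ε 0) t (v t)) t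

theorem exists_flow (hP : AEMeasurable P volume) (hχ : ∀ ξ, χ (-ξ) = χ ξ)
    (hε : ε = 1 ∨ ε = -1) :
    ∃ (Φ : L2 d → C(ℝ, L2 d)) (v : L2 d → ℝ → L2 d),
      (∀ u₀ t, Φ u₀ t = schrodingerGroup hP t (v u₀ t)) ∧
      ∀ u₀, IsInteractionSolution hP χ σ ε u₀ (v u₀) := by
  have hU := isIsometricGroup_schrodingerGroup hP
  have hA := isLocallyLipschitz_nlsOp_zero (χ := χ) (σ := σ) hε le_rfl
  choose v hv0 hv using exists_interaction_solution hU hA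
    (fun u f => re_inner_saturatedMul σ hχ ε u f)
  refine ⟨fun u₀ => ⟨fun t => schrodingerGroup hP t (v u₀ t), ?_⟩, v, fun _ _ => rfl,
    fun u₀ => ⟨hv0 u₀, hv u₀⟩⟩
  exact hU.continuous_apply continuous_id
    (continuous_iff_continuousAt.2 fun t => (hv u₀ t).continuousAt)

theorem IsInteractionSolution.norm_sub_le {hP : AEMeasurable P volume} {u₀ v₀ : L2 d}
    {v w : ℝ → L2 d} (hv : IsInteractionSolution hP χ σ ε u₀ v)
    (hw : IsInteractionSolution hP χ σ ε v₀ w) (hχ : ∀ ξ, χ (-ξ) = χ ξ) (hε : ε = 1 ∨ ε = -1)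
    {W R : ℝ} (hW : supNorm 0 (schwartzKernel χ) ≤ W) (hu₀ : ‖u₀‖ ≤ R) (hv₀ : ‖v₀‖ ≤ R) {t T : ℝ}
    (ht : t ∈ Icc (-T) T) : ‖v t - w t‖ ≤ ‖u₀ - v₀‖ * Real.exp (rateL2 σ W R * T) := by
  have h := norm_interaction_sub_le (isIsometricGroup_schrodingerGroup hP)
    (isLocallyLipschitz_nlsOp_zero hε hW) (fun u f => re_inner_saturatedMul σ hχ ε u f)
    hv.deriv hw.deriv (R := R) (by rwa [hv.init]) (by rwa [hw.init]) ht
  rwa [hv.init, hw.init] at h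

theorem IsInteractionSolution.exists_lift {hP : AEMeasurable P volume} {u₀ : L2 d}
    {v : ℝ → L2 d} (hv : IsInteractionSolution hP χ σ ε u₀ v) (hχ : ∀ ξ, χ (-ξ) = χ ξ)
    (hε : ε = 1 ∨ ε = -1) {s : ℕ} (hu₀ : MemHs s u₀) :
    ∃ g : ℝ → L2 d, ‖g 0‖ = hsNorm s u₀ ∧ (∀ t, bessel s (g t) = v t) ∧
      ∀ t, HasDerivAt g (schrodingerGroup hP (-t)
        (nlsOp χ σ ε s (schrodingerGroup hP t (v t)) (schrodingerGroup hP t (g t)))) t := by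
  have hU := isIsometricGroup_schrodingerGroup hP
  obtain ⟨g, hg0, hgv, hg⟩ := exists_lift_interaction_solution hU
    (isLocallyLipschitz_nlsOp_zero hε le_rfl) (fun u f => re_inner_saturatedMul σ hχ ε u f) hU
    (isLocallyLipschitz_nlsOp hε s le_rfl) (bessel_schrodingerGroup hP s)
    (fun u g => bessel_saturatedMul s σ (schwartzKernel χ) _ u g) hv.deriv
    (g₀ := besselInv s u₀ hu₀) (by rw [hv.init, bessel_besselInv])
  exact ⟨g, by rw [hg0, ← hsNorm_bessel s, bessel_besselInv], hgv, hg⟩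

theorem continuousInHs_flow (hP : AEMeasurable P volume) {s : ℕ} {g v u : ℝ → L2 d}
    (hg : Continuous g) (hgv : ∀ t, bessel s (g t) = v t)
    (hu : ∀ t, u t = schrodingerGroup hP t (v t)) : ContinuousInHs s u := by
  have hU := isIsometricGroup_schrodingerGroup hP
  have h : ∀ t, u t = bessel s (schrodingerGroup hP t (g t)) := fun t => by
    rw [bessel_schrodingerGroup, hgv, hu]
  have hc : Continuous fun t => schrodingerGroup hP t (g t) :=
    hU.continuous_apply continuous_id hg
  refine ⟨fun t => by rw [h]; exact memHs_bessel s _, fun t => ?_⟩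
  have h1 := tendsto_iff_norm_sub_tendsto_zero.1 (hc.tendsto t)
  refine h1.congr fun τ => ?_
  rw [h, h, ← map_sub, hsNorm_bessel]

theorem uniformContinuousOn_of_norm_sub_le {Φ : L2 d → C(ℝ, L2 d)} {R C : ℝ}
    (h : ∀ u₀ v₀ : L2 d, ‖u₀‖ ≤ R → ‖v₀‖ ≤ R → ∀ T, ∀ t ∈ Icc (-T) T,
      ‖Φ u₀ t - Φ v₀ t‖ ≤ ‖u₀ - v₀‖ * Real.exp (C * T)) :
    UniformContinuousOn Φ (Metric.closedBall 0 R) := by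
  rw [UniformContinuousOn, ContinuousMap.hasBasis_compactConvergenceUniformity.tendsto_right_iff]
  rintro ⟨K, V⟩ ⟨hK, hV⟩
  obtain ⟨δ, hδ, hδV⟩ := Metric.mem_uniformity_dist.1 hV
  obtain ⟨T, hT⟩ := hK.isBounded.exists_norm_le
  have hpos := Real.exp_pos (C * T)
  -- On [-T, T], which contains the compact set K, distances grow by at most exp(CT), so initial
  -- data are taken within δ/exp(CT).
  have hmem : {p : L2 d × L2 d | dist p.1 p.2 < δ / Real.exp (C * T)} ∈ uniformity (L2 d) :=
    Metric.dist_mem_uniformity (by positivity)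
  filter_upwards [mem_inf_of_left hmem, mem_inf_of_right (mem_principal_self _)]
    with ⟨u₀, v₀⟩ h1 h2 t ht
  refine hδV ?_
  rw [dist_eq_norm]
  refine (h u₀ v₀ (by simpa using h2.1) (by simpa using h2.2) T t
    (abs_le.1 (hT t ht))).trans_lt ?_
  rw [← lt_div_iff₀ hpos, ← dist_eq_norm]
  exact h1

end Flow

end SaturatedNLS

end

/-! ### The main theorem. -/

theorem mainTheorem1 (d σ : ℕ) :
    ∃ (C₀ : ℝ → ℝ → ℝ → ℝ) (C : ℕ → ℝ → ℝ → ℝ → ℝ),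
      ∀ (ε : ℝ), (ε = 1 ∨ ε = -1) →
      ∀ (P : SaturatedNLS.Space d → ℝ), AEMeasurable P volume →
      ∀ (χ : SchwartzMap (SaturatedNLS.Space d) ℝ), (∀ ξ, χ (-ξ) = χ ξ) →
      -- `Φ u₀` is the unique solution with initial datum `u₀`
      ∃ Φ : SaturatedNLS.L2 d → C(ℝ, SaturatedNLS.L2 d),
        (∀ u₀, SaturatedNLS.IsSolution P χ σ ε (Φ u₀) ∧ Φ u₀ 0 = u₀ ∧
          ∀ u : C(ℝ, SaturatedNLS.L2 d),
            SaturatedNLS.IsSolution P χ σ ε u → u 0 = u₀ → u = Φ u₀) ∧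
        -- conservation of the `L²` norm
        (∀ u₀ t, ‖Φ u₀ t‖ = ‖u₀‖) ∧
        -- propagation of `H^s` regularity
        (∀ (s : ℕ) (u₀ : SaturatedNLS.L2 d), SaturatedNLS.MemHs s u₀ →
          SaturatedNLS.ContinuousInHs s (Φ u₀)) ∧
        -- uniform continuity of the flow on balls, for locally uniform convergence in time
        (∀ R : ℝ, UniformContinuousOn Φ (Metric.closedBall 0 R)) ∧
        -- Lipschitz bound in `L²`
        (∀ (u₀ v₀ : SaturatedNLS.L2 d) (T : ℝ), 0 < T → ∀ t ∈ Set.Icc (-T) T,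
          ‖Φ u₀ t - Φ v₀ t‖ ≤ ‖u₀ - v₀‖ * Real.exp
            (C₀ (eLpNorm (SaturatedNLS.kernel χ) ∞ volume).toReal ‖u₀‖ ‖v₀‖ * T)) ∧
        -- Lipschitz bound in `H^s`
        (∀ (s : ℕ) (u₀ v₀ : SaturatedNLS.L2 d),
          SaturatedNLS.MemHs s u₀ → SaturatedNLS.MemHs s v₀ →
          ∀ T : ℝ, 0 < T → ∀ t ∈ Set.Icc (-T) T,
            SaturatedNLS.hsNorm s (Φ u₀ t - Φ v₀ t) ≤
              SaturatedNLS.hsNorm s (u₀ - v₀) * Real.exp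
                (C s (SaturatedNLS.wInfNorm s (SaturatedNLS.kernel χ))
                  (SaturatedNLS.hsNorm s u₀) (SaturatedNLS.hsNorm s v₀) * T)) := by
  -- The radius is the larger of the two data norms, so both data lie in the ball on which the rates
  -- are computed.
  refine ⟨fun W a b => SaturatedNLS.rateL2 σ W (max a b),
    fun s W a b => SaturatedNLS.rateHs d σ s W (max a b), fun ε hε P hP χ hχ => ?_⟩
  obtain ⟨Φ, v, hΦ, hv⟩ := SaturatedNLS.exists_flow (χ := χ) (σ := σ) hP hχ hε
  have hU := SaturatedNLS.isIsometricGroup_schrodingerGroup hP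
  have hskew := fun u f => SaturatedNLS.re_inner_saturatedMul σ hχ ε u f
  have hL2 : ∀ {W R : ℝ}, SaturatedNLS.supNorm 0 (SaturatedNLS.schwartzKernel χ) ≤ W →
      ∀ u₀ v₀ : SaturatedNLS.L2 d, ‖u₀‖ ≤ R → ‖v₀‖ ≤ R → ∀ T, ∀ t ∈ Set.Icc (-T) T,
      ‖Φ u₀ t - Φ v₀ t‖ ≤ ‖u₀ - v₀‖ * Real.exp (SaturatedNLS.rateL2 σ W R * T) := by
    intro W R hW u₀ v₀ hu hv' T t ht
    rw [hΦ, hΦ, ← map_sub, hU.norm]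
    exact (hv u₀).norm_sub_le (hv v₀) hχ hε hW hu hv' ht
  refine ⟨Φ, fun u₀ => ⟨?_, ?_, ?_⟩, ?_, ?_, ?_, ?_, ?_⟩
  · exact SaturatedNLS.isSolution_of_interaction hP (hv u₀).deriv (hΦ u₀)
  · rw [hΦ, hU.zero, (hv u₀).init]
  · intro u hu hu0
    -- Uniqueness is the stability estimate with equal data: any solution, carried to the
    -- interaction picture, is at distance 0 from the constructed one.
    have hw : SaturatedNLS.IsInteractionSolution hP χ σ ε u₀
        fun t => SaturatedNLS.schrodingerGroup hP (-t) (u t) :=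
      ⟨by simp only [neg_zero, hU.zero, hu0], SaturatedNLS.interaction_of_isSolution hP
        (SaturatedNLS.isLocallyLipschitz_nlsOp_zero hε le_rfl).continuous hu⟩
    ext1 t
    have h := hw.norm_sub_le (hv u₀) hχ hε le_rfl le_rfl le_rfl
      (abs_le.1 le_rfl : t ∈ Set.Icc (-|t|) |t|)
    rw [sub_self, norm_zero, zero_mul, norm_le_zero_iff, sub_eq_zero] at h
    rw [hΦ, ← h, hU.apply_neg]
  · intro u₀ t
    rw [hΦ, hU.norm, SaturatedNLS.norm_interaction_eq hU hskew (hv u₀).deriv, (hv u₀).init]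
  · intro s u₀ hu₀
    obtain ⟨g, -, hgv, hg⟩ := (hv u₀).exists_lift hχ hε hu₀
    exact SaturatedNLS.continuousInHs_flow hP
      (continuous_iff_continuousAt.2 fun t => (hg t).continuousAt) hgv (hΦ u₀)
  · intro R
    exact SaturatedNLS.uniformContinuousOn_of_norm_sub_le (hL2 le_rfl)
  · intro u₀ v₀ T _ t ht
    exact hL2 (SaturatedNLS.supNorm_zero_le_eLpNorm χ) u₀ v₀ (le_max_left _ _) (le_max_right _ _)
      T t ht
  · intro s u₀ v₀ hu₀ hv₀ T hT t ht
    obtain ⟨g, hg0, hgv, hg⟩ := (hv u₀).exists_lift hχ hε hu₀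
    obtain ⟨h, hh0, hhv, hh⟩ := (hv v₀).exists_lift hχ hε hv₀
    have hW := SaturatedNLS.supNorm_le_wInfNorm s χ
    have key := SaturatedNLS.norm_lift_interaction_sub_le hU
      (SaturatedNLS.isLocallyLipschitz_nlsOp_zero hε
        ((SaturatedNLS.supNorm_zero_le s _).trans hW)) hskew hU
      (SaturatedNLS.isLocallyLipschitz_nlsOp hε s hW) (SaturatedNLS.norm_bessel_le s)
      (hv u₀).deriv (hv v₀).deriv hgv hhv hg hh (hg0.trans_le (le_max_left _ _))
      (hh0.trans_le (le_max_right _ _)) hT.le ht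
    -- The H^s norms of both differences become L² norms of preimages under `bessel s`, where `key`
    -- applies.
    have h1 : Φ u₀ t - Φ v₀ t
        = SaturatedNLS.bessel s (SaturatedNLS.schrodingerGroup hP t (g t - h t)) := by
      rw [SaturatedNLS.bessel_schrodingerGroup, map_sub, hgv, hhv, map_sub, hΦ, hΦ]
    have h2 : u₀ - v₀ = SaturatedNLS.bessel s (g 0 - h 0) := by
      rw [map_sub, hgv, hhv, (hv u₀).init, (hv v₀).init]
    rw [h1, h2, SaturatedNLS.hsNorm_bessel, SaturatedNLS.hsNorm_bessel, hU.norm]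
    exact key
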